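/- Let $M>0$ and $0<|\chi|\le 1$, put $a=M\chi$ and $r_+=M(1+\sqrt{1-\chi^2})$, and consider the exterior $r>r_+$ of the Kerr black hole of mass $M$ and dimensionless spin $\chi$ in Boyer--Lindquist coordinates $(t,r,\theta,\phi)$. For a metric $g$ let ${R}{}^{*}\!R=R_{\beta\alpha\gamma\delta}\,{}^{*}\!R^{\alpha\beta\gamma\delta}$, with ${}^{*}\!R^{\alpha\beta\gamma\delta}=\tfrac12\epsilon^{\gamma\delta\rho\sigma}R^{\alpha\beta}{}_{\rho\sigma}$ and $\epsilon_{tr\theta\phi}=+\sqrt{-g}$, be the Pontryagin density, and let $\phi_0=(r-M)\cos\theta$. (i) On the Kerr exterior $\Box\phi_0=0$, and $\phi_0/(r\cos\theta)\to1$ as $r\to\infty$ (where $\cos\theta\neq0$). (ii) The Kerr density ${R}{}^{*}\!R\,\phi_0\sqrt{-g}$ is integrable over the slice $t=\mathrm{const}$, and for all real $\epsilon$ $$\frac{\epsilon}{4\pi}\int_{r_+}^{\infty}\!\int_0^{\pi}\!\int_0^{2\pi}{R}{}^{*}\!R\;\phi_0\,\sqrt{-g}\;d\phi\,d\theta\,dr=\frac{2\epsilon\left[2\chi^4+\left(2\sqrt{1-\chi^2}-3\right)\chi^2-2\sqrt{1-\chi^2}+2\right]}{\chi^3}.$$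 (iii) Let $(g_\epsilon,\Phi_\epsilon)$ be a family of stationary axisymmetric metrics and scalar fields, given in terms of $(r,\theta)$, such that $g_0$ is the Kerr metric; $g_\epsilon(r,\theta)$ is smooth in $(\epsilon,r,\theta)$ near $(0,r,\theta)$ for each $r>r_+$, $0<\theta<\pi$; $\Phi_\epsilon$ is smooth in $(\epsilon,1/r,\theta)$ near $\epsilon=0$, up to and including the horizon $r=r_+$, the axis and $1/r=0$; and at each point of the exterior the dynamical Chern--Simons scalar equation $\Box_{g_\epsilon}\Phi_\epsilon+\epsilon\,{R}{}^{*}\!R[g_\epsilon]=0$ holds for all sufficiently small $|\epsilon|$. Suppose that for all small $|\epsilon|$ and all $\theta\in[0,\pi]$ $$\Phi_\epsilon(r,\theta)=\frac{\mu_1(\epsilon,\theta)}{r}+\frac{\mu_2(\epsilon,\theta)}{r^2}+\mathcal O(r^{-3})\qquad(r\to\infty).$$ Then the $\ell=1$ mode $\mu_{(2,1)}(\epsilon)=\tfrac32\int_0^\pi\mu_2(\epsilon,\theta)\cos\theta\sin\theta\,d\theta$ of the dipole hair satisfies $$\mu_{(2,1)}(\epsilon)=\frac{2\epsilon\left[2\chi^4+\left(2\sqrt{1-\chi^2}-3\right)\chi^2-2\sqrt{1-\chi^2}+2\right]}{\chi^3}+\mathcal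 O(\epsilon^2)\qquad(\epsilon\to0).$$ -/

import Mathlib

open Real Set Filter Topology MeasureTheory Asymptotics
open scoped ContDiff

noncomputable section

namespace DCS

/-! ### Tensor calculus in a coordinate chart of a four-dimensional spacetime -/

/-- Coordinates `(x 0, x 1, x 2, x 3) = (t, r, θ, φ)`. -/
abbrev Coord := Fin 4 → ℝ

/-- A metric in the chart: the matrix of components `g_{ab}` at each point. -/
abbrev Metric := Coord → Matrix (Fin 4) (Fin 4) ℝ

/-- The partial derivative `∂_i f`. -/
def pd (i : Fin 4) (f : Coord → ℝ) (x : Coord) : ℝ :=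
  deriv (fun s => f (Function.update x i s)) (x i)

/-- The volume density `√(-det g)`. -/
def sqrtNegDet (g : Metric) (x : Coord) : ℝ := √(-(g x).det)

/-- The Christoffel symbols `Γ^a_{bc}` of the Levi-Civita connection. -/
def christoffel (g : Metric) (a b c : Fin 4) (x : Coord) : ℝ :=
  (1 / 2) * ∑ d, (g x)⁻¹ a d *
    (pd b (fun y => g y d c) x + pd c (fun y => g y d b) x - pd d (fun y => g y b c) x)

/-- The Riemann tensor `R^a_{bcd} = ∂_c Γ^a_{bd} - ∂_d Γ^a_{bc} + Γ^a_{ce} Γ^e_{bd}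
- Γ^a_{de} Γ^e_{bc}`. -/
def riemann (g : Metric) (a b c d : Fin 4) (x : Coord) : ℝ :=
  pd c (christoffel g a b d) x - pd d (christoffel g a b c) x
    + ∑ e, (christoffel g a c e x * christoffel g e b d x
      - christoffel g a d e x * christoffel g e b c x)

/-- The permutation symbol `[abcd]`: the determinant of the matrix with rows `e_a, e_b, e_c, e_d`,
that is, the sign of `(a,b,c,d)` if it is a permutation of `(0,1,2,3)`, and `0` otherwise. -/
def permSymbol (a b c d : Fin 4) : ℤ :=
  (Matrix.of fun i j : Fin 4 => if ![a, b, c, d] i = j then (1 : ℤ) else 0).det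

/-- The contravariant Levi-Civita tensor `ε^{abcd} = -[abcd] / √(-g)`, for the orientation
in which `(t, r, θ, φ)` is positive, i.e. `ε_{trθφ} = +√(-g)`. -/
def leviCivitaUp (g : Metric) (a b c d : Fin 4) (x : Coord) : ℝ :=
  -(permSymbol a b c d : ℝ) / sqrtNegDet g x

/-- The dual Riemann tensor `*R^a_b^{cd} = (1/2) ε^{cdef} R^a_{bef}`. -/
def dualRiemann (g : Metric) (a b c d : Fin 4) (x : Coord) : ℝ :=
  (1 / 2) * ∑ e, ∑ f, leviCivitaUp g c d e f x * riemann g a b e f x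

/-- The Pontryagin density `R_{bacd} *R^{abcd} = R^b_{acd} *R^a_b^{cd}`. -/
def pontryagin (g : Metric) (x : Coord) : ℝ :=
  ∑ a, ∑ b, ∑ c, ∑ d, riemann g b a c d x * dualRiemann g a b c d x

/-- The wave operator `□ Φ = g^{ab} ∇_a ∇_b Φ = g^{ab} (∂_a ∂_b Φ - Γ^c_{ab} ∂_c Φ)`. -/
def box (g : Metric) (Φ : Coord → ℝ) (x : Coord) : ℝ :=
  ∑ a, ∑ b, (g x)⁻¹ a b * (pd a (pd b Φ) x - ∑ c, christoffel g c a b x * pd c Φ x)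

/-! ### The Kerr black hole in Boyer-Lindquist coordinates -/

/-- The outer (event) horizon radius `r₊ = M (1 + √(1 - χ²))`. -/
def rPlus (M χ : ℝ) : ℝ := M * (1 + √(1 - χ ^ 2))

/-- `Σ = r² + a² cos² θ`, with `a = M χ`. -/
def kerrSigma (M χ r θ : ℝ) : ℝ := r ^ 2 + (M * χ) ^ 2 * cos θ ^ 2

/-- `Δ = r² - 2 M r + a²`, with `a = M χ`. -/
def kerrDelta (M χ r : ℝ) : ℝ := r ^ 2 - 2 * M * r + (M * χ) ^ 2

/-- Components in `(t, r, θ, φ)` of the Kerr metric of mass `M` and dimensionless spin `χ`. -/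
def kerrMatrix (M χ r θ : ℝ) : Matrix (Fin 4) (Fin 4) ℝ :=
  !![-(1 - 2 * M * r / kerrSigma M χ r θ), 0, 0,
      -(2 * M * (M * χ) * r * sin θ ^ 2 / kerrSigma M χ r θ);
    0, kerrSigma M χ r θ / kerrDelta M χ r, 0, 0;
    0, 0, kerrSigma M χ r θ, 0;
    -(2 * M * (M * χ) * r * sin θ ^ 2 / kerrSigma M χ r θ), 0, 0,
      (r ^ 2 + (M * χ) ^ 2
        + 2 * M * (M * χ) ^ 2 * r * sin θ ^ 2 / kerrSigma M χ r θ) * sin θ ^ 2]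

/-- The Kerr metric. -/
def kerr (M χ : ℝ) : Metric := fun x => kerrMatrix M χ (x 1) (x 2)

/-- The homogeneous solution `φ₀ = (r - M) P₁(cos θ)` on Kerr. -/
def phi0 (M : ℝ) : Coord → ℝ := fun x => (x 1 - M) * cos (x 2)

/-- The chart domain `r > r₊`, `0 < θ < π`, `0 < φ < 2π` of a slice `t = const` of the exterior. -/
def slice (M χ : ℝ) : Set (ℝ × ℝ × ℝ) :=
  Ioi (rPlus M χ) ×ˢ (Ioo 0 π ×ˢ Ioo 0 (2 * π))

/-- The density `R*R · φ₀ · √(-g)` of Kerr on the slice `t = 0`, as a function of `(r, θ, φ)`. -/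
def hairIntegrand (M χ : ℝ) (p : ℝ × ℝ × ℝ) : ℝ :=
  pontryagin (kerr M χ) ![0, p.1, p.2.1, p.2.2] * phi0 M ![0, p.1, p.2.1, p.2.2]
    * sqrtNegDet (kerr M χ) ![0, p.1, p.2.1, p.2.2]

/-! ### Families of solutions with a smooth expansion in the coupling -/

/-- The stationary axisymmetric metric with components `G r θ` in `(t, r, θ, φ)`. -/
def stationaryMetric (G : ℝ → ℝ → Matrix (Fin 4) (Fin 4) ℝ) : Metric := fun x => G (x 1) (x 2)

/-- The stationary axisymmetric scalar field with values `Φ r θ`. -/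
def stationaryScalar (Φ : ℝ → ℝ → ℝ) : Coord → ℝ := fun x => Φ (x 1) (x 2)

/-- A family, indexed by the coupling `ε`, of stationary axisymmetric metrics and scalar fields
with a smooth perturbative expansion about the Kerr black hole, that solve the scalar field equation
`□ Φ + ε R*R = 0` of dynamical Chern-Simons gravity. No other field equation is imposed on the
metric, so that all solutions of the complete field equations, and also scalar fields on the fixed
Kerr background, are covered. -/
structure Family (M χ : ℝ) where
  /-- The metric components at coupling `ε`, as functions of `(r, θ)`. -/
  metric : ℝ → ℝ → ℝ → Matrix (Fin 4) (Fin 4) ℝ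
  /-- The scalar field at coupling `ε`, as a function of `(r, θ)`. -/
  scalar : ℝ → ℝ → ℝ → ℝ
  metric_symm : ∀ ε r θ, (metric ε r θ).IsSymm
  /-- At zero coupling the metric is the Kerr metric, on the whole exterior. -/
  metric_zero : ∀ r θ, rPlus M χ < r → θ ∈ Ioo 0 π → metric 0 r θ = kerrMatrix M χ r θ
  /-- The metric depends smoothly on the coupling and on the point, locally in the exterior. -/
  metric_smooth : ∀ r θ, rPlus M χ < r → θ ∈ Ioo 0 π → ∀ i j,
    ContDiffAt ℝ ∞ (fun p : ℝ × ℝ × ℝ => metric p.1 p.2.1 p.2.2 i j) (0, r, θ)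
  /-- The scalar field is smooth in `(ε, 1/r, θ)` for `ε` near `0`, up to and including the
  horizon, the axis and spatial infinity. -/
  scalar_smooth : ∃ U : ℝ × ℝ × ℝ → ℝ,
    (∀ s ∈ Icc 0 (1 / rPlus M χ), ∀ θ ∈ Icc 0 π, ContDiffAt ℝ ∞ U (0, s, θ)) ∧
    ∀ ε r θ, 0 < r → scalar ε r θ = U (ε, 1 / r, θ)
  /-- The scalar field equation holds at each point of the exterior for all small couplings (the
  range may depend on the point, as the horizon may move with the coupling). -/
  field_eq : ∀ r θ, rPlus M χ < r → θ ∈ Ioo 0 π → ∀ᶠ ε in 𝓝 (0 : ℝ), ∀ t φ,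
    box (stationaryMetric (metric ε)) (stationaryScalar (scalar ε)) ![t, r, θ, φ]
      + ε * pontryagin (stationaryMetric (metric ε)) ![t, r, θ, φ] = 0

/-- `μ₁` and `μ₂` are the monopole and the dipole hair of the family of scalar fields `Φ`:
`Φ = μ₁(θ)/r + μ₂(θ)/r² + O(r⁻³)` as `r → ∞`, for all small couplings. -/
def IsHair (Φ : ℝ → ℝ → ℝ → ℝ) (μ₁ μ₂ : ℝ → ℝ → ℝ) : Prop :=
  ∀ᶠ ε in 𝓝 (0 : ℝ), ∀ θ ∈ Icc 0 π,
    (fun r => Φ ε r θ - μ₁ ε θ / r - μ₂ ε θ / r ^ 2) =O[atTop] fun r : ℝ => 1 / r ^ 3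

/-- The `ℓ = 1` mode of an axisymmetric function on the sphere: the coefficient of `P₁(cos θ)`
in its Legendre expansion. -/
def legendreOne (f : ℝ → ℝ) : ℝ := (3 / 2) * ∫ θ in (0 : ℝ)..π, f θ * cos θ * sin θ

end DCS

end

noncomputable section

namespace DCS

/-! ### The Pontryagin density as a trace -/

/-! The dipole hair is read off from Green's identity on Kerr, tested against `φ₀ = (r - M) cos θ`.

At zero coupling the scalar field is a regular harmonic function on the Kerr exterior that vanishes
at infinity, hence it is zero (`StripDerivs.eq_zero`). Differentiating `□Φ + ε R*R = 0` at `ε = 0`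
therefore leaves no trace of the metric perturbation, which only multiplies derivatives of `Φ₀ = 0`.
The first-order field `V = ∂Φ/∂ε` solves `□V = -R*R` on the fixed Kerr background
(`SmoothMetricAt.box_couplingDeriv`).

On stationary axisymmetric functions `Σ □` is `∂_r Δ ∂_r` plus the Laplacian of the round sphere
(`box_kerr`), so the projection of `V` on `cos θ` satisfies an ordinary differential equation in `r`
with homogeneous solution `r - M`. The Wronskian of the two, times `Δ`, has the projected source as
its derivative. It vanishes at the horizon because `Δ` does and `V` is smooth there. At infinity it
first forces the `ℓ = 1` part of the `1/r` coefficient of `V` to vanish, and then equals a multiple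
of the `1/r²` coefficient (`StripDerivs.dipole`). So that coefficient is the integral of `R*R φ₀
√(-g)`.

The integral is elementary. The Kerr curvature is linear in the real and imaginary parts of `M / (r
- i a cos θ)³`, and `R*R √(-g)` is a multiple of their product (`pontryagin_kerr_mul_sqrtNegDet`).
Explicit primitives exist, first in `θ` and then in `s = 1/r` (`integral_pontryaginDensity_mul_cos`,
`hasDerivAt_tailPrimitive`). Only the value of `tailPrimitive` at the horizon survives, both in the
integral and in the hair.

The remainder `O(ε²)` comes from smoothness in `(ε, 1/r, θ)` up to `1/r = 0`: the coefficient of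
`1/r²` is half the second `s`-derivative at `s = 0`, and its `ℓ = 1` mode is twice differentiable in
`ε`. -/

/-- The sum of `[abcd] A_{ab} B_{cd}` for antisymmetric `A` and `B`. -/
theorem sum_permSymbol_mul (A B : Fin 4 → Fin 4 → ℝ) (hA : ∀ i j, A j i = -A i j)
    (hB : ∀ i j, B j i = -B i j) :
    ∑ a, ∑ b, ∑ c, ∑ d, (permSymbol a b c d : ℝ) * A a b * B c d =
      4 * (A 0 1 * B 2 3 - A 0 2 * B 1 3 + A 0 3 * B 1 2
        + A 1 2 * B 0 3 - A 1 3 * B 0 2 + A 2 3 * B 0 1) := by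
  -- The sign of a permutation is the sign of its Vandermonde product, and the product vanishes on a
  -- repeated index; the 256 cases are decided at once.
  have h : ∀ a b c d : Fin 4, permSymbol a b c d =
      ((b : ℤ) - a).sign * ((c : ℤ) - a).sign * ((d : ℤ) - a).sign * ((c : ℤ) - b).sign *
        ((d : ℤ) - b).sign * ((d : ℤ) - c).sign := by
    decide +kernel
  have h2 : Int.sign 2 = 1 := rfl
  have h3 : Int.sign 3 = 1 := rfl
  simp only [h, Fin.sum_univ_four]
  simp [Fin.coe_ofNat_eq_mod, h2, h3]
  rw [hA 0 1, hA 0 2, hA 0 3, hA 1 2, hA 1 3, hA 2 3, hB 0 1, hB 0 2, hB 0 3, hB 1 2, hB 1 3,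
    hB 2 3]
  ring

theorem riemann_swap (g : Metric) (a b c d : Fin 4) (x : Coord) :
    riemann g a b d c x = -riemann g a b c d x := by
  simp only [riemann, Finset.sum_sub_distrib]
  ring

/-- Antisymmetry in the last index pair leaves only the three splittings `01|23`, `02|13`, `03|12`
of the index set. What remains is a trace of products of curvature matrices, so six matrices `R^i_{j
kl}` suffice to evaluate the density on Kerr. -/
theorem pontryagin_eq_sum (g : Metric) (x : Coord) :
    pontryagin g x = -(4 / sqrtNegDet g x) * ∑ a, ∑ b,
      (riemann g a b 0 1 x * riemann g b a 2 3 x - riemann g a b 0 2 x * riemann g b a 1 3 x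
        + riemann g a b 0 3 x * riemann g b a 1 2 x) := by
  have key : ∀ a b : Fin 4, ∑ c, ∑ d, riemann g b a c d x * dualRiemann g a b c d x =
      -(1 / (2 * sqrtNegDet g x)) * ∑ c, ∑ d, ∑ e, ∑ f,
        (permSymbol c d e f : ℝ) * riemann g b a c d x * riemann g a b e f x := by
    intro a b
    simp only [dualRiemann, leviCivitaUp, Finset.mul_sum]
    refine Finset.sum_congr rfl fun c _ => Finset.sum_congr rfl fun d _ =>
      Finset.sum_congr rfl fun e _ => Finset.sum_congr rfl fun f _ => ?_
    ring
  have hsw : ∑ a, ∑ b, (riemann g b a 0 1 x * riemann g a b 2 3 x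
      - riemann g b a 0 2 x * riemann g a b 1 3 x + riemann g b a 0 3 x * riemann g a b 1 2 x) =
      ∑ a, ∑ b, (riemann g a b 0 1 x * riemann g b a 2 3 x
      - riemann g a b 0 2 x * riemann g b a 1 3 x + riemann g a b 0 3 x * riemann g b a 1 2 x) :=
    Finset.sum_comm
  have key2 : ∀ a b : Fin 4, ∑ c, ∑ d, riemann g b a c d x * dualRiemann g a b c d x =
      -(2 / sqrtNegDet g x) * ((riemann g b a 0 1 x * riemann g a b 2 3 x
      - riemann g b a 0 2 x * riemann g a b 1 3 x + riemann g b a 0 3 x * riemann g a b 1 2 x)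
      + (riemann g a b 0 1 x * riemann g b a 2 3 x
      - riemann g a b 0 2 x * riemann g b a 1 3 x
      + riemann g a b 0 3 x * riemann g b a 1 2 x)) := by
    intro a b
    rw [key, sum_permSymbol_mul (fun c d => riemann g b a c d x) (fun e f => riemann g a b e f x)
      (fun i j => riemann_swap g b a i j x) (fun i j => riemann_swap g a b i j x)]
    ring
  simp only [pontryagin, key2]
  simp only [← Finset.mul_sum, Finset.sum_add_distrib (f := fun b => _ - _ + _)]
  simp only [Finset.sum_add_distrib] at hsw ⊢
  linear_combination (-(2 / sqrtNegDet g x)) * hsw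

/-! ### Locality of the differential operators -/

theorem continuousAt_update (i : Fin 4) (x : Coord) :
    Tendsto (fun s => Function.update x i s) (𝓝 (x i)) (𝓝 x) := by
  have h : Continuous (fun s => Function.update x i s) := continuous_const.update i continuous_id
  have := h.tendsto (x i)
  rwa [Function.update_eq_self] at this

theorem pd_congr {f f' : Coord → ℝ} {x : Coord} (i : Fin 4) (h : f =ᶠ[𝓝 x] f') :
    pd i f x = pd i f' x :=
  Filter.EventuallyEq.deriv_eq ((continuousAt_update i x).eventually h)

theorem pd_congr_nhds {f f' : Coord → ℝ} {x : Coord} (i : Fin 4) (h : f =ᶠ[𝓝 x] f') :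
    pd i f =ᶠ[𝓝 x] pd i f' :=
  (eventually_eventually_nhds.2 h).mono fun _ hy => pd_congr i hy

theorem christoffel_congr {g g' : Metric} {x : Coord} (h : g =ᶠ[𝓝 x] g') (a b c : Fin 4) :
    christoffel g a b c x = christoffel g' a b c x := by
  have hc : ∀ i j, (fun y => g y i j) =ᶠ[𝓝 x] fun y => g' y i j := fun i j =>
    h.mono fun y hy => by simp only [hy]
  simp only [christoffel, h.eq_of_nhds, pd_congr _ (hc _ _)]

theorem christoffel_congr_nhds {g g' : Metric} {x : Coord} (h : g =ᶠ[𝓝 x] g') (a b c : Fin 4) :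
    christoffel g a b c =ᶠ[𝓝 x] christoffel g' a b c :=
  (eventually_eventually_nhds.2 h).mono fun _ hy => christoffel_congr hy a b c

theorem riemann_congr {g g' : Metric} {x : Coord} (h : g =ᶠ[𝓝 x] g') (a b c d : Fin 4) :
    riemann g a b c d x = riemann g' a b c d x := by
  simp only [riemann, christoffel_congr h, pd_congr _ (christoffel_congr_nhds h _ _ _)]

/-- Locality is needed because the metric of a family at zero coupling is Kerr only on the exterior,
which is open. -/
theorem pontryagin_congr {g g' : Metric} {x : Coord} (h : g =ᶠ[𝓝 x] g') :
    pontryagin g x = pontryagin g' x := by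
  simp only [pontryagin_eq_sum, riemann_congr h, sqrtNegDet, h.eq_of_nhds]

theorem box_congr {g g' : Metric} {Φ Φ' : Coord → ℝ} {x : Coord} (h : g =ᶠ[𝓝 x] g')
    (hΦ : Φ =ᶠ[𝓝 x] Φ') : box g Φ x = box g' Φ' x := by
  simp only [box, christoffel_congr h, h.eq_of_nhds, pd_congr _ hΦ,
    pd_congr _ (pd_congr_nhds _ hΦ)]

/-! ### Partial derivatives of functions of `(r, θ)` -/

theorem pd_zero_stationary (F : ℝ → ℝ → ℝ) (x : Coord) : pd 0 (fun y => F (y 1) (y 2)) x = 0 := by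
  simp [pd]

theorem pd_three_stationary (F : ℝ → ℝ → ℝ) (x : Coord) : pd 3 (fun y => F (y 1) (y 2)) x = 0 := by
  simp [pd]

theorem pd_one_stationary (F : ℝ → ℝ → ℝ) :
    pd 1 (fun y => F (y 1) (y 2)) = fun x => deriv (fun r => F r (x 2)) (x 1) := by
  ext x
  simp [pd]

theorem pd_two_stationary (F : ℝ → ℝ → ℝ) :
    pd 2 (fun y => F (y 1) (y 2)) = fun x => deriv (fun θ => F (x 1) θ) (x 2) := by
  ext x
  simp [pd]

end DCS

namespace DCS

/-! ### The Kerr metric and its Christoffel symbols -/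

/-- The quantities on which the Kerr metric depends rationally: `M`, `a`, `r`, `cos θ`, `sin θ`,
`Σ`, `Δ`. -/
structure KerrData where
  M : ℝ
  a : ℝ
  r : ℝ
  c : ℝ
  s : ℝ
  S : ℝ
  D : ℝ

namespace KerrData

/-- The relations between the entries of `KerrData` at a point of the exterior. -/
structure Regular (x : KerrData) : Prop where
  S_ne : x.S ≠ 0
  D_ne : x.D ≠ 0
  s_ne : x.s ≠ 0
  pyth : x.s ^ 2 + x.c ^ 2 = 1
  S_eq : x.S = x.r ^ 2 + x.a ^ 2 * x.c ^ 2
  D_eq : x.D = x.r ^ 2 - 2 * x.M * x.r + x.a ^ 2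

/-- `v` is the velocity at time `t` of a curve of data with fixed `M` and `a`. -/
structure IsVelocity (γ : ℝ → KerrData) (v : KerrData) (t : ℝ) : Prop where
  M : ∀ u, (γ u).M = (γ t).M
  a : ∀ u, (γ u).a = (γ t).a
  r : HasDerivAt (fun u => (γ u).r) v.r t
  c : HasDerivAt (fun u => (γ u).c) v.c t
  s : HasDerivAt (fun u => (γ u).s) v.s t
  S : HasDerivAt (fun u => (γ u).S) v.S t
  D : HasDerivAt (fun u => (γ u).D) v.D t

variable (x v : KerrData)

/-- `P` and `B` are chosen so that `∂_r H = -2 P` and `∂_θ H = 2 a² s B`. Each definition with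
prefix `d` is the derivative of its namesake along the velocity `v`, so one formula serves both the
`r` and the `θ` direction. -/
def q : ℝ := x.r ^ 2 + x.a ^ 2
def H : ℝ := 2 * x.M * x.r / x.S
def P : ℝ := x.M * (x.r ^ 2 - x.a ^ 2 * x.c ^ 2) / x.S ^ 2
def B : ℝ := 2 * x.M * x.r * x.c / x.S ^ 2
def C : ℝ := x.c * x.s / x.S
def dq : ℝ := 2 * x.r * v.r
def dH : ℝ := 2 * x.M * (v.r / x.S - x.r * v.S / x.S ^ 2)
def dP : ℝ := 2 * x.M * ((x.r * v.r - x.a ^ 2 * x.c * v.c) / x.S ^ 2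
  - (x.r ^ 2 - x.a ^ 2 * x.c ^ 2) * v.S / x.S ^ 3)
def dB : ℝ := 2 * x.M * ((v.r * x.c + x.r * v.c) / x.S ^ 2 - 2 * x.r * x.c * v.S / x.S ^ 3)
def dC : ℝ := (v.c * x.s + x.c * v.s) / x.S - x.c * x.s * v.S / x.S ^ 2

def gtφ : ℝ := -(x.a * x.H * x.s ^ 2)
def grr : ℝ := x.S / x.D
def gφφ : ℝ := (x.q + x.a ^ 2 * x.H * x.s ^ 2) * x.s ^ 2
def dgtφ : ℝ := -(x.a * (x.dH v * x.s ^ 2 + x.H * (2 * x.s * v.s)))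
def dgrr : ℝ := v.S / x.D - x.S * v.D / x.D ^ 2
def dgφφ : ℝ := (x.dq v + x.a ^ 2 * (x.dH v * x.s ^ 2 + x.H * (2 * x.s * v.s))) * x.s ^ 2
  + (x.q + x.a ^ 2 * x.H * x.s ^ 2) * (2 * x.s * v.s)

/-- The components of the Kerr metric. -/
def metric : Matrix (Fin 4) (Fin 4) ℝ :=
  !![x.H - 1, 0, 0, x.gtφ; 0, x.grr, 0, 0; 0, 0, x.S, 0; x.gtφ, 0, 0, x.gφφ]

/-- The derivative of the components of the Kerr metric along a curve. -/
def dmetric : Matrix (Fin 4) (Fin 4) ℝ :=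
  !![x.dH v, 0, 0, x.dgtφ v; 0, x.dgrr v, 0, 0; 0, 0, v.S, 0; x.dgtφ v, 0, 0, x.dgφφ v]

/-- The components of the inverse Kerr metric. -/
def inv : Matrix (Fin 4) (Fin 4) ℝ :=
  !![-(x.q ^ 2 - x.D * x.a ^ 2 * x.s ^ 2) / (x.S * x.D), 0, 0, -(x.a * x.H / x.D);
    0, x.D / x.S, 0, 0;
    0, 0, 1 / x.S, 0;
    -(x.a * x.H / x.D), 0, 0, (x.D - x.a ^ 2 * x.s ^ 2) / (x.S * x.D * x.s ^ 2)]

def Γttr : ℝ := x.q * x.P / x.D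
def Γttθ : ℝ := -(x.a ^ 2 * x.B * x.s)
def Γtrφ : ℝ := -(x.a * x.s ^ 2 * (x.q * x.P + x.r * x.H) / x.D)
def Γtθφ : ℝ := x.a ^ 3 * x.B * x.s ^ 3
def Γrtt : ℝ := x.D * x.P / x.S
def Γrtφ : ℝ := -(x.a * x.s ^ 2 * x.D * x.P / x.S)
def Γrrr : ℝ := x.r / x.S - (x.r - x.M) / x.D
def Γrrθ : ℝ := -(x.a ^ 2 * x.C)
def Γrθθ : ℝ := -(x.r * x.D / x.S)
def Γrφφ : ℝ := x.D * x.s ^ 2 * (x.a ^ 2 * x.s ^ 2 * x.P - x.r) / x.S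
def Γθtt : ℝ := -(x.a ^ 2 * x.B * x.s / x.S)
def Γθtφ : ℝ := x.a * x.q * x.B * x.s / x.S
def Γθrr : ℝ := x.a ^ 2 * x.C / x.D
def Γθrθ : ℝ := x.r / x.S
def Γθφφ : ℝ := -(x.q * x.C + x.a ^ 2 * x.s ^ 3 * x.B * (1 + x.q / x.S))
def Γφtr : ℝ := x.a * x.P / x.D
def Γφtθ : ℝ := -(x.a * x.B / x.s)
def Γφrφ : ℝ := (x.r - x.r * x.H - x.a ^ 2 * x.s ^ 2 * x.P) / x.D
def Γφθφ : ℝ := x.c / x.s + x.a ^ 2 * x.B * x.s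

/-- The Christoffel symbols `Γ^i_{jk}` of the Kerr metric. -/
def Γ : Fin 4 → Matrix (Fin 4) (Fin 4) ℝ :=
  ![!![0, x.Γttr, x.Γttθ, 0; x.Γttr, 0, 0, x.Γtrφ; x.Γttθ, 0, 0, x.Γtθφ; 0, x.Γtrφ, x.Γtθφ, 0],
    !![x.Γrtt, 0, 0, x.Γrtφ; 0, x.Γrrr, x.Γrrθ, 0; 0, x.Γrrθ, x.Γrθθ, 0; x.Γrtφ, 0, 0, x.Γrφφ],
    !![x.Γθtt, 0, 0, x.Γθtφ; 0, x.Γθrr, x.Γθrθ, 0; 0, x.Γθrθ, x.Γrrθ, 0; x.Γθtφ, 0, 0, x.Γθφφ],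
    !![0, x.Γφtr, x.Γφtθ, 0; x.Γφtr, 0, 0, x.Γφrφ; x.Γφtθ, 0, 0, x.Γφθφ; 0, x.Γφrφ, x.Γφθφ, 0]]

/-- The velocity of the data along the `r` coordinate line. -/
def velr : KerrData := ⟨0, 0, 1, 0, 0, 2 * x.r, 2 * x.r - 2 * x.M⟩

/-- The velocity of the data along the `θ` coordinate line. -/
def velθ : KerrData := ⟨0, 0, 0, -x.s, x.c, -(2 * x.a ^ 2 * x.c * x.s), 0⟩

/-- The partial derivatives of the components of the Kerr metric. -/
def pdmetric : Fin 4 → Matrix (Fin 4) (Fin 4) ℝ := ![0, x.dmetric x.velr, x.dmetric x.velθ, 0]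

variable {x}

/-- The seven entries of the data are treated as independent symbols. Once denominators are cleared,
substituting `D`, `S` and `c² = 1 - s²` turns each component into a polynomial identity; the other
component checks follow the same pattern. -/
theorem metric_mul_inv (hx : x.Regular) : x.metric * x.inv = 1 := by
  obtain ⟨hS, hD, hs, hcs, eS, eD⟩ := hx
  obtain ⟨M, a, r, c, s, S, D⟩ := x
  simp only at hS hD hs hcs eS eD
  have hc : c ^ 2 = 1 - s ^ 2 := by linarith
  rw [hc] at eS
  ext i j
  fin_cases i <;> fin_cases j <;>
    simp [metric, inv, Matrix.mul_apply, Fin.sum_univ_four, H, gtφ, grr, gφφ, q] <;>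
    field_simp <;> (try rw [eD, eS]) <;> ring

/-- The Christoffel symbols are verified with the first index lowered, which keeps the inverse
metric out of the component algebra. -/
theorem sum_metric_mul_Γ (hx : x.Regular) (i j k : Fin 4) :
    ∑ d, x.metric i d * x.Γ d j k =
      (1 / 2) * (x.pdmetric j i k + x.pdmetric k i j - x.pdmetric i j k) := by
  obtain ⟨hS, hD, hs, hcs, eS, eD⟩ := hx
  obtain ⟨M, a, r, c, s, S, D⟩ := x
  simp only at hS hD hs hcs eS eD
  have hc : c ^ 2 = 1 - s ^ 2 := by linarith
  rw [hc] at eS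
  fin_cases i <;> fin_cases j <;> fin_cases k <;>
    simp only [Fin.zero_eta, Fin.mk_one, Fin.reduceFinMk, Fin.isValue, Fin.sum_univ_four, metric,
      pdmetric, dmetric, Γ, Matrix.of_apply, Matrix.cons_val, mul_zero, zero_mul, add_zero, zero_add,
      Matrix.zero_apply, sub_zero]
  all_goals
    simp only [Γttr, Γttθ, Γtrφ, Γtθφ, Γrtt, Γrtφ, Γrrr, Γrrθ, Γrθθ, Γrφφ, Γθtt, Γθtφ, Γθrr, Γθrθ,
      Γθφφ, Γφtr, Γφtθ, Γφrφ, Γφθφ, velr, velθ, dH, dgtφ, dgrr, dgφφ, H, gtφ, grr, gφφ, q, dq, B, P,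
      C]
    try field_simp
    try simp only [hc]
    try rw [eD]
    try rw [eS]
    try ring

end KerrData
end DCS

namespace DCS
namespace KerrData

/-! ### Derivatives of the metric and of the Christoffel symbols -/

variable (x v : KerrData)

def dΓttr : ℝ := (x.dq v * x.P + x.q * x.dP v) / x.D - x.q * x.P * v.D / x.D ^ 2
def dΓttθ : ℝ := -(x.a ^ 2 * (x.dB v * x.s + x.B * v.s))
def dΓtrφ : ℝ :=
  -(x.a * (2 * x.s * v.s * (x.q * x.P + x.r * x.H)
    + x.s ^ 2 * (x.dq v * x.P + x.q * x.dP v + v.r * x.H + x.r * x.dH v)) / x.D)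
    + x.a * x.s ^ 2 * (x.q * x.P + x.r * x.H) * v.D / x.D ^ 2
def dΓtθφ : ℝ := x.a ^ 3 * (x.dB v * x.s ^ 3 + x.B * (3 * x.s ^ 2 * v.s))
def dΓrtt : ℝ := (v.D * x.P + x.D * x.dP v) / x.S - x.D * x.P * v.S / x.S ^ 2
def dΓrtφ : ℝ := -(x.a * (2 * x.s * v.s * x.Γrtt + x.s ^ 2 * x.dΓrtt v))
def dΓrrr : ℝ := v.r / x.S - x.r * v.S / x.S ^ 2 - v.r / x.D + (x.r - x.M) * v.D / x.D ^ 2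
def dΓrrθ : ℝ := -(x.a ^ 2 * x.dC v)
def dΓrθθ : ℝ := -((v.r * x.D + x.r * v.D) / x.S - x.r * x.D * v.S / x.S ^ 2)
def dΓrφφ : ℝ :=
  (v.D * x.s ^ 2 + x.D * (2 * x.s * v.s)) * (x.a ^ 2 * x.s ^ 2 * x.P - x.r) / x.S
    + x.D * x.s ^ 2 * (x.a ^ 2 * (2 * x.s * v.s * x.P + x.s ^ 2 * x.dP v) - v.r) / x.S
    - x.D * x.s ^ 2 * (x.a ^ 2 * x.s ^ 2 * x.P - x.r) * v.S / x.S ^ 2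
def dΓθtt : ℝ := -(x.a ^ 2 * ((x.dB v * x.s + x.B * v.s) / x.S - x.B * x.s * v.S / x.S ^ 2))
def dΓθtφ : ℝ := x.a * ((x.dq v * x.B * x.s + x.q * x.dB v * x.s + x.q * x.B * v.s) / x.S
  - x.q * x.B * x.s * v.S / x.S ^ 2)
def dΓθrr : ℝ := x.a ^ 2 * (x.dC v / x.D - x.C * v.D / x.D ^ 2)
def dΓθrθ : ℝ := v.r / x.S - x.r * v.S / x.S ^ 2
def dΓθφφ : ℝ := -(x.dq v * x.C + x.q * x.dC v
  + x.a ^ 2 * (3 * x.s ^ 2 * v.s * x.B + x.s ^ 3 * x.dB v) * (1 + x.q / x.S)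
  + x.a ^ 2 * x.s ^ 3 * x.B * (x.dq v / x.S - x.q * v.S / x.S ^ 2))
def dΓφtr : ℝ := x.a * (x.dP v / x.D - x.P * v.D / x.D ^ 2)
def dΓφtθ : ℝ := -(x.a * (x.dB v / x.s - x.B * v.s / x.s ^ 2))
def dΓφrφ : ℝ :=
  (v.r - v.r * x.H - x.r * x.dH v - x.a ^ 2 * (2 * x.s * v.s * x.P + x.s ^ 2 * x.dP v)) / x.D
    - (x.r - x.r * x.H - x.a ^ 2 * x.s ^ 2 * x.P) * v.D / x.D ^ 2
def dΓφθφ : ℝ := v.c / x.s - x.c * v.s / x.s ^ 2 + x.a ^ 2 * (x.dB v * x.s + x.B * v.s)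

/-- The derivative of the Christoffel symbols along a curve. -/
def dΓ : Fin 4 → Matrix (Fin 4) (Fin 4) ℝ :=
  ![!![0, x.dΓttr v, x.dΓttθ v, 0; x.dΓttr v, 0, 0, x.dΓtrφ v;
      x.dΓttθ v, 0, 0, x.dΓtθφ v; 0, x.dΓtrφ v, x.dΓtθφ v, 0],
    !![x.dΓrtt v, 0, 0, x.dΓrtφ v; 0, x.dΓrrr v, x.dΓrrθ v, 0;
      0, x.dΓrrθ v, x.dΓrθθ v, 0; x.dΓrtφ v, 0, 0, x.dΓrφφ v],
    !![x.dΓθtt v, 0, 0, x.dΓθtφ v; 0, x.dΓθrr v, x.dΓθrθ v, 0;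
      0, x.dΓθrθ v, x.dΓrrθ v, 0; x.dΓθtφ v, 0, 0, x.dΓθφφ v],
    !![0, x.dΓφtr v, x.dΓφtθ v, 0; x.dΓφtr v, 0, 0, x.dΓφrφ v;
      x.dΓφtθ v, 0, 0, x.dΓφθφ v; 0, x.dΓφrφ v, x.dΓφθφ v, 0]]

variable {x v} {γ : ℝ → KerrData} {t : ℝ}

namespace IsVelocity

theorem hasDerivAt_M (h : IsVelocity γ v t) : HasDerivAt (fun u => (γ u).M) 0 t := by
  simpa only [h.M] using hasDerivAt_const t (γ t).M

theorem hasDerivAt_a (h : IsVelocity γ v t) : HasDerivAt (fun u => (γ u).a) 0 t := by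
  simpa only [h.a] using hasDerivAt_const t (γ t).a

theorem hasDerivAt_q (h : IsVelocity γ v t) : HasDerivAt (fun u => (γ u).q) ((γ t).dq v) t :=
  ((h.r.fun_pow 2).fun_add (h.hasDerivAt_a.fun_pow 2)).congr_deriv (by
    simp only [dq, Nat.cast_ofNat, Nat.add_one_sub_one, pow_one]; ring)

theorem hasDerivAt_s_pow (h : IsVelocity γ v t) (n : ℕ) :
    HasDerivAt (fun u => (γ u).s ^ n) (n * (γ t).s ^ (n - 1) * v.s) t := h.s.fun_pow n

theorem hasDerivAt_a_pow (h : IsVelocity γ v t) (n : ℕ) :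
    HasDerivAt (fun u => (γ u).a ^ n) 0 t := by
  simpa only [mul_zero] using h.hasDerivAt_a.fun_pow n

theorem hasDerivAt_H (h : IsVelocity γ v t) (hS : (γ t).S ≠ 0) :
    HasDerivAt (fun u => (γ u).H) ((γ t).dH v) t :=
  ((h.hasDerivAt_M.const_mul 2 |>.fun_mul h.r).fun_div h.S hS).congr_deriv (by
    simp only [dH]; field_simp; ring)

theorem hasDerivAt_P (h : IsVelocity γ v t) (hS : (γ t).S ≠ 0) :
    HasDerivAt (fun u => (γ u).P) ((γ t).dP v) t :=
  ((h.hasDerivAt_M.fun_mul ((h.r.fun_pow 2).fun_sub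
    ((h.hasDerivAt_a_pow 2).fun_mul (h.c.fun_pow 2)))).fun_div (h.S.fun_pow 2)
    (pow_ne_zero 2 hS)).congr_deriv (by
    simp only [dP, Nat.cast_ofNat, Nat.add_one_sub_one, pow_one]; field_simp; ring)

theorem hasDerivAt_B (h : IsVelocity γ v t) (hS : (γ t).S ≠ 0) :
    HasDerivAt (fun u => (γ u).B) ((γ t).dB v) t :=
  (((h.hasDerivAt_M.const_mul 2 |>.fun_mul h.r).fun_mul h.c).fun_div (h.S.fun_pow 2)
    (pow_ne_zero 2 hS)).congr_deriv (by
    simp only [dB, Nat.cast_ofNat, Nat.add_one_sub_one, pow_one]; field_simp; ring)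

theorem hasDerivAt_C (h : IsVelocity γ v t) (hS : (γ t).S ≠ 0) :
    HasDerivAt (fun u => (γ u).C) ((γ t).dC v) t :=
  ((h.c.fun_mul h.s).fun_div h.S hS).congr_deriv (by
    simp only [dC]; field_simp)

theorem hasDerivAt_metric (h : IsVelocity γ v t) (hx : (γ t).Regular) (i j : Fin 4) :
    HasDerivAt (fun u => (γ u).metric i j) ((γ t).dmetric v i j) t := by
  have hS := hx.S_ne
  have hD := hx.D_ne
  have hH := h.hasDerivAt_H hS
  have h00 : HasDerivAt (fun u => (γ u).H - 1) ((γ t).dH v) t := hH.sub_const 1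
  have h03 : HasDerivAt (fun u => (γ u).gtφ) ((γ t).dgtφ v) t :=
    ((h.hasDerivAt_a.fun_mul hH).fun_mul (h.hasDerivAt_s_pow 2)).fun_neg.congr_deriv (by
      simp only [dgtφ, Nat.cast_ofNat, Nat.add_one_sub_one, pow_one]; ring)
  have h11 : HasDerivAt (fun u => (γ u).grr) ((γ t).dgrr v) t :=
    (h.S.fun_div h.D hD).congr_deriv (by simp only [dgrr]; field_simp)
  have h33 : HasDerivAt (fun u => (γ u).gφφ) ((γ t).dgφφ v) t :=
    ((h.hasDerivAt_q.fun_add (((h.hasDerivAt_a_pow 2).fun_mul hH).fun_mul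
      (h.hasDerivAt_s_pow 2))).fun_mul (h.hasDerivAt_s_pow 2)).congr_deriv (by
      simp only [dgφφ, Nat.cast_ofNat, Nat.add_one_sub_one, pow_one]; ring)
  fin_cases i <;> fin_cases j <;>
    first
      | exact hasDerivAt_const _ _
      | exact h00
      | exact h03
      | exact h11
      | exact h.S
      | exact h33

theorem hasDerivAt_Γ (h : IsVelocity γ v t) (hx : (γ t).Regular) (i j k : Fin 4) :
    HasDerivAt (fun u => (γ u).Γ i j k) ((γ t).dΓ v i j k) t := by
  have hS := hx.S_ne
  have hD := hx.D_ne
  have hs := hx.s_ne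
  have ha := h.hasDerivAt_a
  have ha2 := h.hasDerivAt_a_pow 2
  have hs2 := h.hasDerivAt_s_pow 2
  have hs3 := h.hasDerivAt_s_pow 3
  have hq := h.hasDerivAt_q
  have hH := h.hasDerivAt_H hS
  have hP := h.hasDerivAt_P hS
  have hB := h.hasDerivAt_B hS
  have hC := h.hasDerivAt_C hS
  have httr : HasDerivAt (fun u => (γ u).Γttr) ((γ t).dΓttr v) t :=
    ((hq.fun_mul hP).fun_div h.D hD).congr_deriv (by simp only [dΓttr]; field_simp)
  have httθ : HasDerivAt (fun u => (γ u).Γttθ) ((γ t).dΓttθ v) t :=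
    ((ha2.fun_mul hB).fun_mul h.s).fun_neg.congr_deriv (by simp only [dΓttθ]; ring)
  have htrφ : HasDerivAt (fun u => (γ u).Γtrφ) ((γ t).dΓtrφ v) t :=
    (((ha.fun_mul hs2).fun_mul ((hq.fun_mul hP).fun_add (h.r.fun_mul hH))).fun_div h.D
      hD).fun_neg.congr_deriv (by simp only [dΓtrφ]; field_simp; simp; ring)
  have htθφ : HasDerivAt (fun u => (γ u).Γtθφ) ((γ t).dΓtθφ v) t :=
    (((h.hasDerivAt_a_pow 3).fun_mul hB).fun_mul hs3).congr_deriv (by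
      simp [dΓtθφ]; ring)
  have hrtt : HasDerivAt (fun u => (γ u).Γrtt) ((γ t).dΓrtt v) t :=
    ((h.D.fun_mul hP).fun_div h.S hS).congr_deriv (by simp only [dΓrtt]; field_simp)
  have hrtφ : HasDerivAt (fun u => (γ u).Γrtφ) ((γ t).dΓrtφ v) t :=
    ((((ha.fun_mul hs2).fun_mul h.D).fun_mul hP).fun_div h.S hS).fun_neg.congr_deriv (by
      simp only [dΓrtφ, dΓrtt, Γrtt]; field_simp; simp; ring)
  have hrrr : HasDerivAt (fun u => (γ u).Γrrr) ((γ t).dΓrrr v) t :=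
    ((h.r.fun_div h.S hS).fun_sub ((h.r.fun_sub h.hasDerivAt_M).fun_div h.D hD)).congr_deriv (by
      simp only [dΓrrr]; field_simp; ring)
  have hrrθ : HasDerivAt (fun u => (γ u).Γrrθ) ((γ t).dΓrrθ v) t :=
    (ha2.fun_mul hC).fun_neg.congr_deriv (by simp only [dΓrrθ]; ring)
  have hrθθ : HasDerivAt (fun u => (γ u).Γrθθ) ((γ t).dΓrθθ v) t :=
    ((h.r.fun_mul h.D).fun_div h.S hS).fun_neg.congr_deriv (by simp only [dΓrθθ]; field_simp)
  have hrφφ : HasDerivAt (fun u => (γ u).Γrφφ) ((γ t).dΓrφφ v) t :=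
    (((h.D.fun_mul hs2).fun_mul (((ha2.fun_mul hs2).fun_mul hP).fun_sub h.r)).fun_div h.S
      hS).congr_deriv (by simp only [dΓrφφ]; field_simp; simp; ring)
  have hθtt : HasDerivAt (fun u => (γ u).Γθtt) ((γ t).dΓθtt v) t :=
    (((ha2.fun_mul hB).fun_mul h.s).fun_div h.S hS).fun_neg.congr_deriv (by
      simp only [dΓθtt]; field_simp; ring)
  have hθtφ : HasDerivAt (fun u => (γ u).Γθtφ) ((γ t).dΓθtφ v) t :=
    ((((ha.fun_mul hq).fun_mul hB).fun_mul h.s).fun_div h.S hS).congr_deriv (by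
      simp only [dΓθtφ]; field_simp; ring)
  have hθrr : HasDerivAt (fun u => (γ u).Γθrr) ((γ t).dΓθrr v) t :=
    ((ha2.fun_mul hC).fun_div h.D hD).congr_deriv (by simp only [dΓθrr]; field_simp; ring)
  have hθrθ : HasDerivAt (fun u => (γ u).Γθrθ) ((γ t).dΓθrθ v) t :=
    (h.r.fun_div h.S hS).congr_deriv (by simp only [dΓθrθ]; field_simp)
  have hθφφ : HasDerivAt (fun u => (γ u).Γθφφ) ((γ t).dΓθφφ v) t :=
    ((hq.fun_mul hC).fun_add (((ha2.fun_mul hs3).fun_mul hB).fun_mul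
      ((hq.fun_div h.S hS).const_add 1))).fun_neg.congr_deriv (by
      simp only [dΓθφφ]; field_simp; simp; ring)
  have hφtr : HasDerivAt (fun u => (γ u).Γφtr) ((γ t).dΓφtr v) t :=
    ((ha.fun_mul hP).fun_div h.D hD).congr_deriv (by simp only [dΓφtr]; field_simp; ring)
  have hφtθ : HasDerivAt (fun u => (γ u).Γφtθ) ((γ t).dΓφtθ v) t :=
    ((ha.fun_mul hB).fun_div h.s hs).fun_neg.congr_deriv (by simp only [dΓφtθ]; field_simp; ring)
  have hφrφ : HasDerivAt (fun u => (γ u).Γφrφ) ((γ t).dΓφrφ v) t :=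
    (((h.r.fun_sub (h.r.fun_mul hH)).fun_sub ((ha2.fun_mul hs2).fun_mul hP)).fun_div h.D
      hD).congr_deriv (by simp only [dΓφrφ]; field_simp; simp; ring)
  have hφθφ : HasDerivAt (fun u => (γ u).Γφθφ) ((γ t).dΓφθφ v) t :=
    ((h.c.fun_div h.s hs).fun_add ((ha2.fun_mul hB).fun_mul h.s)).congr_deriv (by
      simp only [dΓφθφ]; field_simp; ring)
  fin_cases i <;> fin_cases j <;> fin_cases k <;>
    first
      | with_reducible exact hasDerivAt_const _ _
      | with_reducible_and_instances
          simp only [Γ, dΓ, Matrix.of_apply, Matrix.cons_val, Fin.zero_eta, Fin.mk_one,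
            Fin.reduceFinMk, Fin.isValue]
        first | exact hasDerivAt_const _ _ | assumption

end IsVelocity

end KerrData
end DCS

namespace DCS
namespace KerrData

/-! ### The curvature of the Kerr metric -/

variable (x : KerrData)

/-- The real part of `M / (r - i a cos θ)³`. -/
def X : ℝ := x.M * x.r * (x.r ^ 2 - 3 * x.a ^ 2 * x.c ^ 2) / x.S ^ 3

/-- The imaginary part of `M / (r - i a cos θ)³`, divided by `a`. -/
def Y : ℝ := x.M * x.c * (3 * x.r ^ 2 - x.a ^ 2 * x.c ^ 2) / x.S ^ 3

/-- The partial derivatives of the Christoffel symbols. -/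
def pdΓ : Fin 4 → Fin 4 → Matrix (Fin 4) (Fin 4) ℝ := ![0, x.dΓ x.velr, x.dΓ x.velθ, 0]

/-- The Riemann tensor in terms of the Christoffel symbols and their derivatives. -/
def curvature (i j k l : Fin 4) : ℝ :=
  x.pdΓ k i j l - x.pdΓ l i j k + ∑ e, (x.Γ i k e * x.Γ e j l - x.Γ i l e * x.Γ e j k)

/-- The components `R^i_{j t r}`. -/
def Rtr : Matrix (Fin 4) (Fin 4) ℝ :=
  let w := x.s ^ 2
  let Z := x.Y * x.s
  !![0, x.X * (2 * x.q + x.a ^ 2 * w) / x.D, -(Z * x.a ^ 2 * (x.q + 2 * x.D) / x.D), 0;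
    x.X * (2 * x.D + x.a ^ 2 * w) / x.S, 0, 0, -(x.X * x.a * w * (x.q + 2 * x.D) / x.S);
    -(3 * x.a ^ 2 * Z / x.S), 0, 0, Z * x.a * (2 * x.q + x.a ^ 2 * w) / x.S;
    0, 3 * x.a * x.X / x.D, -(x.Y * x.a * (2 * x.D + x.a ^ 2 * w) / (x.D * x.s)), 0]

/-- The components `R^i_{j t θ}`. -/
def Rtθ : Matrix (Fin 4) (Fin 4) ℝ :=
  let w := x.s ^ 2
  let Z := x.Y * x.s
  !![0, -(Z * x.a ^ 2 * (2 * x.q + x.D) / x.D), -(x.X * (x.q + 2 * x.a ^ 2 * w)), 0;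
    -(3 * x.a ^ 2 * Z * x.D / x.S), 0, 0, Z * x.a * x.D * (x.q + 2 * x.a ^ 2 * w) / x.S;
    -(x.X * (x.D + 2 * x.a ^ 2 * w) / x.S), 0, 0, x.X * x.a * w * (2 * x.q + x.D) / x.S;
    0, -(x.Y * x.a * (x.D + 2 * x.a ^ 2 * w) / (x.D * x.s)), -(3 * x.a * x.X), 0]

/-- The components `R^i_{j t φ}`. -/
def Rtφ : Matrix (Fin 4) (Fin 4) ℝ :=
  let w := x.s ^ 2
  let Z := x.Y * x.s
  !![x.H * x.a * x.X * w, 0, 0, -(x.X * w * (x.q + x.H * x.a ^ 2 * w));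
    0, 0, -(Z * x.a * x.D), 0;
    0, x.a * Z, 0, 0;
    -(x.X * (1 - x.H)), 0, 0, -(x.H * x.a * x.X * w)]

/-- The components `R^i_{j r θ}`. -/
def Rrθ : Matrix (Fin 4) (Fin 4) ℝ :=
  let w := x.s ^ 2
  let Z := x.Y * x.s
  !![-(x.H * x.S * x.a ^ 2 * Z / x.D), 0, 0, Z * x.a * x.S * (x.q + x.H * x.a ^ 2 * w) / x.D;
    0, 0, -(x.X * x.S), 0;
    0, x.X * x.S / x.D, 0, 0;
    x.Y * x.a * x.S * (1 - x.H) / (x.D * x.s), 0, 0, x.H * x.S * x.a ^ 2 * Z / x.D]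

/-- The components `R^i_{j r φ}`. -/
def Rrφ : Matrix (Fin 4) (Fin 4) ℝ :=
  let w := x.s ^ 2
  let Z := x.Y * x.s
  let k := x.q ^ 2 + 2 * x.a ^ 2 * w * x.D
  !![0, 3 * x.a * w * x.q * x.X / x.D, -(Z * x.a * k / x.D), 0;
    x.X * x.a * w * (x.q + 2 * x.D) / x.S, 0, 0, -(x.X * w * k / x.S);
    -(Z * x.a * (x.q + 2 * x.a ^ 2 * w) / x.S), 0, 0, 3 * x.a ^ 2 * x.q * w * Z / x.S;
    0, x.X * (x.q + 2 * x.a ^ 2 * w) / x.D, -(Z * x.a ^ 2 * (x.q + 2 * x.D) / x.D), 0]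

/-- The components `R^i_{j θ φ}`. -/
def Rθφ : Matrix (Fin 4) (Fin 4) ℝ :=
  let w := x.s ^ 2
  let Z := x.Y * x.s
  let k := 2 * x.q ^ 2 + x.a ^ 2 * w * x.D
  !![0, -(Z * x.a * k / x.D), -(3 * x.a * x.q * w * x.X), 0;
    -(Z * x.a * x.D * (2 * x.q + x.a ^ 2 * w) / x.S), 0, 0, 3 * x.a ^ 2 * x.q * w * x.D * Z / x.S;
    -(x.X * x.a * w * (2 * x.q + x.D) / x.S), 0, 0, x.X * w * k / x.S;
    0, -(Z * x.a ^ 2 * (2 * x.q + x.D) / x.D), -(x.X * (2 * x.q + x.a ^ 2 * w)), 0]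

variable {x}

/-- Every entry of the six matrices is a multiple of `X` or of `Y`, so the trace is quadratic in the
two. The identity holds with `X` and `Y` as free variables: the `X²` and `Y²` terms cancel. -/
theorem curvature_trace (hx : x.Regular) :
    ∑ i, ∑ j, (x.Rtr i j * x.Rθφ j i - x.Rtθ i j * x.Rrφ j i + x.Rtφ i j * x.Rrθ j i) =
      -24 * x.a * x.s * x.X * x.Y * x.S := by
  obtain ⟨hS, hD, hs, hcs, eS, eD⟩ := hx
  simp only [Fin.sum_univ_four, Rtr, Rtθ, Rtφ, Rrθ, Rrφ, Rθφ, Matrix.of_apply, Matrix.cons_val,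
    mul_zero, add_zero, zero_add, sub_zero]
  obtain ⟨M, a, r, c, s, S, D⟩ := x
  simp only at hS hD hs hcs eS eD ⊢
  have hc : c ^ 2 = 1 - s ^ 2 := by linarith
  rw [hc] at eS
  generalize X _ = X
  generalize Y _ = Y
  simp only [H, q]
  field_simp
  rw [eD, eS]
  ring

-- Up to sign, `X + i a Y` is the single nonzero Weyl scalar of this vacuum metric of Petrov type D,
-- which is why each curvature component collapses to a multiple of `X` or `Y`.
set_option linter.unusedSimpArgs false in
theorem curvature_eq (hx : x.Regular) (i j : Fin 4) :
    x.curvature i j 0 1 = x.Rtr i j ∧ x.curvature i j 0 2 = x.Rtθ i j ∧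
      x.curvature i j 0 3 = x.Rtφ i j ∧ x.curvature i j 1 2 = x.Rrθ i j ∧
      x.curvature i j 1 3 = x.Rrφ i j ∧ x.curvature i j 2 3 = x.Rθφ i j := by
  obtain ⟨hS, hD, hs, hcs, eS, eD⟩ := hx
  obtain ⟨M, a, r, c, s, S, D⟩ := x
  simp only at hS hD hs hcs eS eD
  have hc : c ^ 2 = 1 - s ^ 2 := by linarith
  have hc4 : c ^ 4 = (1 - s ^ 2) ^ 2 := by rw [← hc]; ring
  rw [hc] at eS
  refine ⟨?_, ?_, ?_, ?_, ?_, ?_⟩ <;> fin_cases i <;> fin_cases j <;>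
    simp only [curvature, pdΓ, dΓ, Fin.zero_eta, Fin.mk_one, Fin.reduceFinMk, Fin.isValue,
      Fin.sum_univ_four, Γ, Rtr, Rtθ, Rtφ, Rrθ, Rrφ, Rθφ, Matrix.of_apply, Matrix.cons_val,
      mul_zero, zero_mul, add_zero, zero_add, Matrix.zero_apply, sub_zero, Pi.zero_apply, sub_self]
  all_goals
    simp only [Γttr, Γttθ, Γtrφ, Γtθφ, Γrtt, Γrtφ, Γrrr, Γrrθ, Γrθθ, Γrφφ, Γθtt, Γθtφ, Γθrr, Γθrθ,
      Γθφφ, Γφtr, Γφtθ, Γφrφ, Γφθφ, velr, velθ, dΓttr, dΓttθ, dΓtrφ, dΓtθφ, dΓrtt, dΓrtφ, dΓrrr,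
      dΓrrθ, dΓrθθ, dΓrφφ, dΓθtt, dΓθtφ, dΓθrr, dΓθrθ, dΓθφφ, dΓφtr, dΓφtθ, dΓφrφ, dΓφθφ, dH, H, q,
      dq, B, dB, P, dP, C, dC, X, Y]
    try field_simp
    try simp only [hc, hc4]
    try rw [eD]
    try rw [eS]
    try first
      | ring1
      | ring_nf
        simp only [hc]
        ring1

end KerrData
end DCS

namespace DCS

/-! ### The Kerr exterior -/

/-- The exterior `r > r₊`, `0 < θ < π`. -/
def exterior (M χ : ℝ) : Set Coord := {x | rPlus M χ < x 1 ∧ x 2 ∈ Ioo 0 π}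

theorem isOpen_exterior (M χ : ℝ) : IsOpen (exterior M χ) :=
  (isOpen_lt continuous_const (continuous_apply 1)).inter
    (isOpen_Ioo.preimage (continuous_apply 2))

/-- The rational data of the Kerr metric at `(r, θ)`. -/
def kerrData (M χ r θ : ℝ) : KerrData :=
  ⟨M, M * χ, r, cos θ, sin θ, kerrSigma M χ r θ, kerrDelta M χ r⟩

theorem kerrMatrix_eq (M χ r θ : ℝ) : kerrMatrix M χ r θ = (kerrData M χ r θ).metric := by
  ext i j
  fin_cases i <;> fin_cases j <;>
    simp [kerrMatrix, kerrData, KerrData.metric, KerrData.H, KerrData.gtφ, KerrData.grr,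
      KerrData.gφφ, KerrData.q]
  all_goals try ring1
  exact Or.inl (by ring)

variable {M χ r θ : ℝ}

theorem rPlus_pos (hM : 0 < M) : 0 < rPlus M χ := by
  unfold rPlus
  positivity

theorem kerrSigma_pos (hr : 0 < r) : 0 < kerrSigma M χ r θ := by
  unfold kerrSigma
  positivity

theorem kerrDelta_eq (hχ : |χ| ≤ 1) :
    kerrDelta M χ r = (r - rPlus M χ) * (r - M * (1 - √(1 - χ ^ 2))) := by
  have h : √(1 - χ ^ 2) ^ 2 = 1 - χ ^ 2 :=
    Real.sq_sqrt (by nlinarith [sq_abs χ, abs_nonneg χ])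
  unfold kerrDelta rPlus
  linear_combination M ^ 2 * h

theorem kerrDelta_pos (hM : 0 < M) (hχ : |χ| ≤ 1) (hr : rPlus M χ < r) : 0 < kerrDelta M χ r := by
  rw [kerrDelta_eq hχ]
  have h : 0 ≤ M * √(1 - χ ^ 2) := by positivity
  refine mul_pos (sub_pos.2 hr) ?_
  unfold rPlus at hr
  nlinarith

theorem kerrData_regular (hM : 0 < M) (hχ : |χ| ≤ 1) (hr : rPlus M χ < r) (hθ : θ ∈ Ioo 0 π) :
    (kerrData M χ r θ).Regular where
  S_ne := (kerrSigma_pos ((rPlus_pos hM).trans hr)).ne'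
  D_ne := (kerrDelta_pos hM hχ hr).ne'
  s_ne := (sin_pos_of_mem_Ioo hθ).ne'
  pyth := sin_sq_add_cos_sq θ
  S_eq := rfl
  D_eq := rfl

theorem isVelocity_r (M χ r θ : ℝ) :
    KerrData.IsVelocity (fun r => kerrData M χ r θ) (kerrData M χ r θ).velr r where
  M _ := rfl
  a _ := rfl
  r := hasDerivAt_id r
  c := hasDerivAt_const _ _
  s := hasDerivAt_const _ _
  S := ((hasDerivAt_pow 2 r).add_const ((M * χ) ^ 2 * cos θ ^ 2)).congr_deriv
    (by simp [KerrData.velr, kerrData])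
  D := (((hasDerivAt_pow 2 r).fun_sub ((hasDerivAt_id' r).const_mul (2 * M))).add_const
    ((M * χ) ^ 2)).congr_deriv (by simp [KerrData.velr, kerrData])

theorem isVelocity_θ (M χ r θ : ℝ) :
    KerrData.IsVelocity (fun θ => kerrData M χ r θ) (kerrData M χ r θ).velθ θ where
  M _ := rfl
  a _ := rfl
  r := hasDerivAt_const _ _
  c := hasDerivAt_cos θ
  s := hasDerivAt_sin θ
  S := (((hasDerivAt_cos θ).fun_pow 2).const_mul ((M * χ) ^ 2) |>.const_add (r ^ 2)).congr_deriv
    (by simp [KerrData.velθ, kerrData]; ring)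
  D := hasDerivAt_const _ _

variable {x : Coord}

theorem regular_of_mem_exterior (hM : 0 < M) (hχ : |χ| ≤ 1) (hx : x ∈ exterior M χ) :
    (kerrData M χ (x 1) (x 2)).Regular := kerrData_regular hM hχ hx.1 hx.2

theorem pd_kerr (hx : (kerrData M χ (x 1) (x 2)).Regular) (i j k : Fin 4) :
    pd i (fun y => kerr M χ y j k) x = (kerrData M χ (x 1) (x 2)).pdmetric i j k := by
  have h : (fun y => kerr M χ y j k) = fun y => (kerrData M χ (y 1) (y 2)).metric j k := by
    ext y
    rw [kerr, kerrMatrix_eq]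
  rw [h]
  fin_cases i
  · exact pd_zero_stationary (fun r θ => (kerrData M χ r θ).metric j k) x
  · exact (congrFun (pd_one_stationary fun r θ => (kerrData M χ r θ).metric j k) x).trans
      ((isVelocity_r M χ (x 1) (x 2)).hasDerivAt_metric hx j k).deriv
  · exact (congrFun (pd_two_stationary fun r θ => (kerrData M χ r θ).metric j k) x).trans
      ((isVelocity_θ M χ (x 1) (x 2)).hasDerivAt_metric hx j k).deriv
  · exact pd_three_stationary (fun r θ => (kerrData M χ r θ).metric j k) x

theorem kerr_inv (hx : (kerrData M χ (x 1) (x 2)).Regular) :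
    (kerr M χ x)⁻¹ = (kerrData M χ (x 1) (x 2)).inv :=
  Matrix.inv_eq_right_inv (by rw [kerr, kerrMatrix_eq]; exact KerrData.metric_mul_inv hx)

theorem christoffel_kerr (hx : (kerrData M χ (x 1) (x 2)).Regular) (i j k : Fin 4) :
    christoffel (kerr M χ) i j k x = (kerrData M χ (x 1) (x 2)).Γ i j k := by
  have h1 := KerrData.sum_metric_mul_Γ hx
  have h2 := KerrData.metric_mul_inv hx
  generalize hX : kerrData M χ (x 1) (x 2) = X at *
  have h3 : X.inv * X.metric = 1 := mul_eq_one_comm.1 h2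
  have h4 : ∀ d, pd j (fun y => kerr M χ y d k) x + pd k (fun y => kerr M χ y d j) x
      - pd d (fun y => kerr M χ y j k) x = 2 * ∑ e, X.metric d e * X.Γ e j k := by
    intro d
    rw [h1, pd_kerr (by rwa [hX]), pd_kerr (by rwa [hX]), pd_kerr (by rwa [hX]), hX]
    ring
  -- Raises the index: applying the inverse metric to the lowered symbols recovers `Γ`.
  have h5 : X.inv.mulVec (X.metric.mulVec fun e => X.Γ e j k) = fun e => X.Γ e j k := by
    rw [Matrix.mulVec_mulVec, h3, Matrix.one_mulVec]
  have h6 := congrFun h5 i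
  simp only [Matrix.mulVec, dotProduct] at h6
  rw [← h6, christoffel, kerr_inv (by rwa [hX]), hX, Finset.mul_sum]
  refine Finset.sum_congr rfl fun d _ => ?_
  rw [h4]
  ring

theorem christoffel_kerr_eventuallyEq (hM : 0 < M) (hχ : |χ| ≤ 1) (hx : x ∈ exterior M χ)
    (i j k : Fin 4) :
    christoffel (kerr M χ) i j k =ᶠ[𝓝 x] fun y => (kerrData M χ (y 1) (y 2)).Γ i j k :=
  ((isOpen_exterior M χ).eventually_mem hx).mono fun _ hy =>
    christoffel_kerr (regular_of_mem_exterior hM hχ hy) i j k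

theorem pd_christoffel_kerr (hM : 0 < M) (hχ : |χ| ≤ 1) (hx : x ∈ exterior M χ)
    (i j k l : Fin 4) :
    pd i (christoffel (kerr M χ) j k l) x = (kerrData M χ (x 1) (x 2)).pdΓ i j k l := by
  have hR := regular_of_mem_exterior hM hχ hx
  rw [pd_congr i (christoffel_kerr_eventuallyEq hM hχ hx j k l)]
  fin_cases i
  · exact pd_zero_stationary (fun r θ => (kerrData M χ r θ).Γ j k l) x
  · exact (congrFun (pd_one_stationary fun r θ => (kerrData M χ r θ).Γ j k l) x).trans
      ((isVelocity_r M χ (x 1) (x 2)).hasDerivAt_Γ hR j k l).deriv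
  · exact (congrFun (pd_two_stationary fun r θ => (kerrData M χ r θ).Γ j k l) x).trans
      ((isVelocity_θ M χ (x 1) (x 2)).hasDerivAt_Γ hR j k l).deriv
  · exact pd_three_stationary (fun r θ => (kerrData M χ r θ).Γ j k l) x

theorem riemann_kerr (hM : 0 < M) (hχ : |χ| ≤ 1) (hx : x ∈ exterior M χ) (i j k l : Fin 4) :
    riemann (kerr M χ) i j k l x = (kerrData M χ (x 1) (x 2)).curvature i j k l := by
  simp only [riemann, pd_christoffel_kerr hM hχ hx,
    christoffel_kerr (regular_of_mem_exterior hM hχ hx), KerrData.curvature]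

theorem sqrtNegDet_kerr (hr : 0 < x 1) (hD : kerrDelta M χ (x 1) ≠ 0) (hθ : x 2 ∈ Ioo 0 π) :
    sqrtNegDet (kerr M χ) x = kerrSigma M χ (x 1) (x 2) * sin (x 2) := by
  have hS := kerrSigma_pos (M := M) (χ := χ) (θ := x 2) hr
  have hs := sin_pos_of_mem_Ioo hθ
  have hdet : -(kerr M χ x).det = (kerrSigma M χ (x 1) (x 2) * sin (x 2)) ^ 2 := by
    have hc : cos (x 2) ^ 2 = 1 - sin (x 2) ^ 2 := by rw [← sin_sq_add_cos_sq (x 2)]; ring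
    rw [kerr, kerrMatrix]
    simp [Matrix.det_succ_row_zero, Fin.sum_univ_succ, Fin.succAbove]
    have eS : kerrSigma M χ (x 1) (x 2) = (x 1) ^ 2 + (M * χ) ^ 2 * (1 - sin (x 2) ^ 2) := by
      rw [kerrSigma, hc]
    have eD : kerrDelta M χ (x 1) = (x 1) ^ 2 - 2 * M * x 1 + (M * χ) ^ 2 := rfl
    have hS0 := hS.ne'
    generalize kerrSigma M χ (x 1) (x 2) = S at *
    generalize kerrDelta M χ (x 1) = D at *
    field_simp
    rw [eD, eS]
    ring
  rw [sqrtNegDet, hdet, Real.sqrt_sq (by positivity)]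

/-- The Pontryagin density of the Kerr metric. -/
theorem pontryagin_kerr_mul_sqrtNegDet (hM : 0 < M) (hχ : |χ| ≤ 1) (hx : x ∈ exterior M χ) :
    pontryagin (kerr M χ) x * sqrtNegDet (kerr M χ) x =
      96 * M ^ 2 * (M * χ) * x 1 * cos (x 2) * sin (x 2)
        * (x 1 ^ 2 - 3 * (M * χ) ^ 2 * cos (x 2) ^ 2) * (3 * x 1 ^ 2 - (M * χ) ^ 2 * cos (x 2) ^ 2)
        / kerrSigma M χ (x 1) (x 2) ^ 5 := by
  have hR := regular_of_mem_exterior hM hχ hx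
  have hr := (rPlus_pos hM).trans hx.1
  have hS := (kerrSigma_pos (M := M) (χ := χ) (θ := x 2) hr).ne'
  have hg : sqrtNegDet (kerr M χ) x ≠ 0 := by
    rw [sqrtNegDet_kerr hr hR.D_ne hx.2]
    exact mul_ne_zero hS hR.s_ne
  have h := KerrData.curvature_eq hR
  rw [pontryagin_eq_sum]
  simp only [riemann_kerr hM hχ hx]
  simp only [fun i j => (h i j).1, fun i j => (h i j).2.1, fun i j => (h i j).2.2.1,
    fun i j => (h i j).2.2.2.1, fun i j => (h i j).2.2.2.2.1, fun i j => (h i j).2.2.2.2.2]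
  rw [KerrData.curvature_trace hR]
  simp only [KerrData.X, KerrData.Y, kerrData]
  field_simp
  ring

/-- The wave operator of the Kerr metric on stationary axisymmetric functions. -/
theorem box_kerr (hM : 0 < M) (hχ : |χ| ≤ 1) (hx : x ∈ exterior M χ) (F : ℝ → ℝ → ℝ) :
    kerrSigma M χ (x 1) (x 2) * box (kerr M χ) (stationaryScalar F) x =
      kerrDelta M χ (x 1) * deriv (deriv fun r => F r (x 2)) (x 1)
        + 2 * (x 1 - M) * deriv (fun r => F r (x 2)) (x 1)
        + deriv (deriv fun θ => F (x 1) θ) (x 2)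
        + cos (x 2) / sin (x 2) * deriv (fun θ => F (x 1) θ) (x 2) := by
  have hR := regular_of_mem_exterior hM hχ hx
  have h0 : pd 0 (stationaryScalar F) = fun y => (fun _ _ => 0 : ℝ → ℝ → ℝ) (y 1) (y 2) :=
    funext fun y => pd_zero_stationary F y
  have h3 : pd 3 (stationaryScalar F) = fun y => (fun _ _ => 0 : ℝ → ℝ → ℝ) (y 1) (y 2) :=
    funext fun y => pd_three_stationary F y
  have h1 : pd 1 (stationaryScalar F) =
      fun y => (fun r θ => deriv (fun r => F r θ) r : ℝ → ℝ → ℝ) (y 1) (y 2) := pd_one_stationary F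
  have h2 : pd 2 (stationaryScalar F) =
      fun y => (fun r θ => deriv (fun θ => F r θ) θ : ℝ → ℝ → ℝ) (y 1) (y 2) := pd_two_stationary F
  have e1 : pd 1 (fun y => (fun r θ => deriv (fun r => F r θ) r : ℝ → ℝ → ℝ) (y 1) (y 2)) x =
    deriv (deriv fun r => F r (x 2)) (x 1) :=
    congrFun (pd_one_stationary fun r θ => deriv (fun r => F r θ) r) x
  have e2 : pd 2 (fun y => (fun r θ => deriv (fun θ => F r θ) θ : ℝ → ℝ → ℝ) (y 1) (y 2)) x =
    deriv (deriv fun θ => F (x 1) θ) (x 2) :=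
    congrFun (pd_two_stationary fun r θ => deriv (fun θ => F r θ) θ) x
  have e1' := congrFun h1 x
  have e2' := congrFun h2 x
  have e0' := congrFun h0 x
  have e3' := congrFun h3 x
  have e0 : ∀ i, pd i (pd 0 (stationaryScalar F)) x = 0 := fun i => by rw [h0]; simp [pd]
  have e3 : ∀ i, pd i (pd 3 (stationaryScalar F)) x = 0 := fun i => by rw [h3]; simp [pd]
  rw [← h1] at e1
  rw [← h2] at e2
  simp only [box, kerr_inv hR, christoffel_kerr hR, Fin.sum_univ_four, KerrData.inv, KerrData.Γ,
    Matrix.of_apply, Matrix.cons_val, e0', e0, e1, e1', e2, e2', e3, e3']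
  obtain ⟨hS, hD, hs, hcs, eS, eD⟩ := hR
  simp only [KerrData.Γrtt, KerrData.Γrtφ, KerrData.Γrrr, KerrData.Γrθθ, KerrData.Γrφφ,
    KerrData.Γθtt, KerrData.Γθtφ, KerrData.Γθrr, KerrData.Γθφφ, KerrData.Γrrθ, KerrData.q,
    KerrData.H, KerrData.P, KerrData.B, KerrData.C, kerrData, zero_mul, mul_zero, add_zero,
    zero_add, sub_zero, zero_sub] at hS hD hs hcs eS eD ⊢
  generalize deriv (deriv fun r => F r (x 2)) (x 1) = Frr
  generalize deriv (deriv fun θ => F (x 1) θ) (x 2) = Fθθ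
  generalize deriv (fun r => F r (x 2)) (x 1) = Fr
  generalize deriv (fun θ => F (x 1) θ) (x 2) = Fθ
  have hc : cos (x 2) ^ 2 = 1 - sin (x 2) ^ 2 := by linarith
  rw [hc] at eS
  generalize kerrSigma M χ (x 1) (x 2) = S at *
  generalize kerrDelta M χ (x 1) = D at *
  field_simp
  simp only [hc]
  rw [eD, eS]
  ring

end DCS

namespace DCS

variable {M χ r θ : ℝ}

/-! ### The homogeneous solution -/

/-- The angular terms give the eigenvalue `-2` of `P₁`, which cancels `2 (r - M) ∂_r` acting on the
linear factor `r - M`. -/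
theorem box_phi0 (hM : 0 < M) (hχ : |χ| ≤ 1) (t φ : ℝ) (hr : rPlus M χ < r) (hθ : θ ∈ Ioo 0 π) :
    box (kerr M χ) (phi0 M) ![t, r, θ, φ] = 0 := by
  have hx : (![t, r, θ, φ] : Coord) ∈ exterior M χ := ⟨hr, hθ⟩
  have h := box_kerr hM hχ hx fun r θ => (r - M) * cos θ
  have hS := (kerrSigma_pos (M := M) (χ := χ) (θ := θ) ((rPlus_pos hM).trans hr)).ne'
  have hs := (sin_pos_of_mem_Ioo hθ).ne'
  have d1 : ∀ θ, (deriv fun r : ℝ => (r - M) * cos θ) = fun _ => cos θ := fun θ => by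
    ext r; simp
  have d2 : (deriv fun θ => (r - M) * cos θ) = fun θ => (r - M) * -sin θ := by
    ext θ; simp
  have d3 : (deriv fun θ => (r - M) * -sin θ) θ = (r - M) * -cos θ := by
    simp
  simp only [Matrix.cons_val, d1, d2, d3, deriv_const] at h
  refine (mul_eq_zero.1 (h.trans ?_)).resolve_left hS
  field_simp
  ring

theorem tendsto_phi0_div (t φ : ℝ) (hθ : cos θ ≠ 0) :
    Tendsto (fun r => phi0 M ![t, r, θ, φ] / (r * cos θ)) atTop (𝓝 1) := by
  have h : Tendsto (fun r : ℝ => 1 - M * r⁻¹) atTop (𝓝 (1 - M * 0)) :=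
    (tendsto_inv_atTop_zero.const_mul M).const_sub 1
  rw [mul_zero, sub_zero] at h
  refine h.congr' ?_
  filter_upwards [eventually_gt_atTop 0] with r hr
  simp only [phi0, Matrix.cons_val]
  field_simp

/-! ### The integral of the Pontryagin density -/

/-- The integral over `θ` of `R*R cos θ √(-g)` on Kerr. -/
def angularDensity (M χ r : ℝ) : ℝ :=
  192 * M ^ 2 * (M * χ) * r * (r ^ 2 - (M * χ) ^ 2) / (r ^ 2 + (M * χ) ^ 2) ^ 4

/-- The density `R*R √(-g)` on Kerr. -/
def pontryaginDensity (M χ r θ : ℝ) : ℝ :=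
  96 * M ^ 2 * (M * χ) * r * cos θ * sin θ * (r ^ 2 - 3 * (M * χ) ^ 2 * cos θ ^ 2)
    * (3 * r ^ 2 - (M * χ) ^ 2 * cos θ ^ 2) / kerrSigma M χ r θ ^ 5

/-- A primitive, in the variable `s = 1/r`, of the density `(r - M) angularDensity dr`. -/
def tailPrimitive (M χ s : ℝ) : ℝ :=
  16 * M ^ 2 * (M * χ) * s ^ 3 * (-4 + 3 * M * s - M * (M * χ) ^ 2 * s ^ 3)
    / (1 + (M * χ) ^ 2 * s ^ 2) ^ 3

theorem continuous_pontryaginDensity (hr : 0 < r) : Continuous (pontryaginDensity M χ r) := by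
  have h : ∀ θ, kerrSigma M χ r θ ^ 5 ≠ 0 := fun θ => (pow_pos (kerrSigma_pos hr) 5).ne'
  have h' : Continuous (kerrSigma M χ r) := by unfold kerrSigma; fun_prop
  unfold pontryaginDensity
  exact Continuous.div (by fun_prop) (h'.pow 5) h

theorem integral_pontryaginDensity_mul_cos (hr : 0 < r) :
    ∫ θ in (0 : ℝ)..π, pontryaginDensity M χ r θ * cos θ = angularDensity M χ r := by
  -- With `c = cos θ`, the derivative of `c³ (r² - a² c²) / Σ⁴` in `c` is `c² (r² - 3 a² c²) (3 r² -
  -- a² c²) / Σ⁵`.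
  have hd : ∀ θ ∈ uIcc 0 π, HasDerivAt (fun θ => -(96 * M ^ 2 * (M * χ) * r * (cos θ ^ 3
      * (r ^ 2 - (M * χ) ^ 2 * cos θ ^ 2)) / kerrSigma M χ r θ ^ 4))
      (pontryaginDensity M χ r θ * cos θ) θ := by
    intro θ _
    have hS := kerrSigma_pos (M := M) (χ := χ) (θ := θ) hr
    have hc := hasDerivAt_cos θ
    have h1 : HasDerivAt (fun θ => kerrSigma M χ r θ)
        (2 * (M * χ) ^ 2 * cos θ * -sin θ) θ :=
      (((hc.fun_pow 2).const_mul ((M * χ) ^ 2)).const_add (r ^ 2)).congr_deriv (by simp; ring)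
    refine ((((hc.fun_pow 3).fun_mul (((hc.fun_pow 2).const_mul ((M * χ) ^ 2)).const_sub
      (r ^ 2))).const_mul (96 * M ^ 2 * (M * χ) * r)).fun_div (h1.fun_pow 4)
      (pow_ne_zero 4 hS.ne')).fun_neg.congr_deriv ?_
    have eS : kerrSigma M χ r θ = r ^ 2 + (M * χ) ^ 2 * cos θ ^ 2 := rfl
    unfold pontryaginDensity
    generalize kerrSigma M χ r θ = S at *
    have hS' := hS.ne'
    field_simp
    simp
    rw [eS]
    ring
  rw [intervalIntegral.integral_eq_sub_of_hasDerivAt hd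
    (((continuous_pontryaginDensity hr).mul continuous_cos).intervalIntegrable _ _)]
  have hq : r ^ 2 + (M * χ) ^ 2 ≠ 0 := by positivity
  simp [kerrSigma, angularDensity]
  field_simp
  ring

/-- Stated in `s = 1/r` because infinity is then the regular point `s = 0`, where the primitive
vanishes. -/
theorem hasDerivAt_tailPrimitive (M χ s : ℝ) :
    HasDerivAt (tailPrimitive M χ) (-(192 * M ^ 2 * (M * χ) * s ^ 2 * (1 - M * s)
      * (1 - (M * χ) ^ 2 * s ^ 2) / (1 + (M * χ) ^ 2 * s ^ 2) ^ 4)) s := by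
  have hid := hasDerivAt_id' s
  have hq : 1 + (M * χ) ^ 2 * s ^ 2 ≠ 0 := by positivity
  refine ((((hid.fun_pow 3).const_mul (16 * M ^ 2 * (M * χ))).fun_mul
    (((hid.const_mul (3 * M)).const_add (-4)).fun_sub
      ((hid.fun_pow 3).const_mul (M * (M * χ) ^ 2)))).fun_div
    ((((hid.fun_pow 2).const_mul ((M * χ) ^ 2)).const_add 1).fun_pow 3)
    (pow_ne_zero 3 hq)).congr_deriv ?_
  field_simp
  simp
  ring

theorem hasDerivAt_tailPrimitive_inv (hr : 0 < r) :
    HasDerivAt (fun r => tailPrimitive M χ r⁻¹) ((r - M) * angularDensity M χ r) r := by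
  refine ((hasDerivAt_tailPrimitive M χ r⁻¹).comp r (hasDerivAt_inv hr.ne')).congr_deriv ?_
  have hq : r ^ 2 + (M * χ) ^ 2 ≠ 0 := by positivity
  unfold angularDensity
  have : 1 + (M * χ) ^ 2 * r⁻¹ ^ 2 = (r ^ 2 + (M * χ) ^ 2) / r ^ 2 := by field_simp
  rw [this]
  field_simp

theorem tailPrimitive_rPlus (hM : 0 < M) (hχ0 : χ ≠ 0) (hχ : |χ| ≤ 1) :
    -(tailPrimitive M χ (rPlus M χ)⁻¹) / 2 =
      2 * (2 * χ ^ 4 + (2 * √(1 - χ ^ 2) - 3) * χ ^ 2 - 2 * √(1 - χ ^ 2) + 2) / χ ^ 3 := by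
  have hk2 : √(1 - χ ^ 2) ^ 2 = 1 - χ ^ 2 :=
    Real.sq_sqrt (by nlinarith [sq_abs χ, abs_nonneg χ])
  have hk0 : 0 ≤ √(1 - χ ^ 2) := Real.sqrt_nonneg _
  unfold tailPrimitive rPlus
  generalize √(1 - χ ^ 2) = k at *
  have hk1 : 1 + k ≠ 0 := by positivity
  have hχ2 : χ ^ 2 = (1 - k) * (1 + k) := by linear_combination hk2
  -- The horizon relation `r₊² + a² = 2 M r₊`, divided by `r₊²`.
  have e1 : 1 + (M * χ) ^ 2 * (M * (1 + k))⁻¹ ^ 2 = 2 / (1 + k) := by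
    field_simp
    rw [hχ2]
    ring
  have hχ4 : χ ^ 4 = ((1 - k) * (1 + k)) ^ 2 := by rw [← hχ2]; ring
  rw [e1]
  field_simp
  rw [hχ4, hχ2]
  ring

/-- `hairIntegrand` on the slice. -/
theorem hairIntegrand_eq (hM : 0 < M) (hχ : |χ| ≤ 1) {p : ℝ × ℝ × ℝ} (hp : p ∈ slice M χ) :
    hairIntegrand M χ p = (p.1 - M) * (pontryaginDensity M χ p.1 p.2.1 * cos p.2.1) := by
  have hx : (![0, p.1, p.2.1, p.2.2] : Coord) ∈ exterior M χ := ⟨hp.1, hp.2.1⟩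
  have h := pontryagin_kerr_mul_sqrtNegDet hM hχ hx
  simp only [Matrix.cons_val] at h
  rw [hairIntegrand, mul_right_comm, h]
  simp only [phi0, pontryaginDensity, Matrix.cons_val]
  ring

theorem measurableSet_slice (M χ : ℝ) : MeasurableSet (slice M χ) :=
  measurableSet_Ioi.prod (measurableSet_Ioo.prod measurableSet_Ioo)

/-- Both quadratic factors are at most `3 Σ` in absolute value, whence `864 = 96 · 3 · 3`. The
quotient `r² / Σ³` that is left decays like `r⁻⁴` because `r² ≤ Σ`. -/
theorem abs_pontryaginDensity_le (hM : 0 < M) (hr : M ≤ r) :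
    |(r - M) * (pontryaginDensity M χ r θ * cos θ)| ≤ 864 * M ^ 2 * |M * χ| * r ^ (-4 : ℝ) := by
  have hr0 : 0 < r := hM.trans_le hr
  have hS := kerrSigma_pos (M := M) (χ := χ) (θ := θ) hr0
  have hSr : r ^ 2 ≤ kerrSigma M χ r θ := by
    unfold kerrSigma; nlinarith [sq_nonneg (M * χ * cos θ)]
  have e : r ^ (-4 : ℝ) = 1 / r ^ 4 := by
    rw [Real.rpow_neg hr0.le, one_div]; norm_cast
  have h1 : |r ^ 2 - 3 * (M * χ) ^ 2 * cos θ ^ 2| ≤ 3 * kerrSigma M χ r θ := by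
    unfold kerrSigma
    rw [abs_le]; constructor <;> nlinarith [sq_nonneg (M * χ * cos θ), sq_nonneg r]
  have h2 : |3 * r ^ 2 - (M * χ) ^ 2 * cos θ ^ 2| ≤ 3 * kerrSigma M χ r θ := by
    unfold kerrSigma
    rw [abs_le]; constructor <;> nlinarith [sq_nonneg (M * χ * cos θ), sq_nonneg r]
  have h3 : |r - M| ≤ r := by rw [abs_of_nonneg (by linarith)]; linarith
  have h4 := abs_cos_le_one θ
  have h5 := abs_sin_le_one θ
  rw [e, pontryaginDensity]
  simp only [abs_mul, abs_div, abs_pow]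
  rw [abs_of_pos hS, abs_of_pos hM, abs_of_pos hr0, abs_of_pos (by norm_num : (0 : ℝ) < 96)]
  generalize kerrSigma M χ r θ = S at *
  calc _ = 96 * M ^ 2 * (M * |χ|) * (|r - M| * (r * |cos θ| * |sin θ| * |cos θ|
        * |r ^ 2 - 3 * (M * χ) ^ 2 * cos θ ^ 2| * |3 * r ^ 2 - (M * χ) ^ 2 * cos θ ^ 2|)
        / S ^ 5) := by
        ring
    _ ≤ 96 * M ^ 2 * (M * |χ|) * (r * (r * 1 * 1 * 1 * (3 * S) * (3 * S)) / S ^ 5) := by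
        gcongr
    _ = 864 * M ^ 2 * (M * |χ|) * (r ^ 2 / S ^ 3) := by field_simp; ring
    _ ≤ 864 * M ^ 2 * (M * |χ|) * (r ^ 2 / (r ^ 2) ^ 3) := by gcongr
    _ = _ := by field_simp

theorem le_rPlus (hM : 0 < M) : M ≤ rPlus M χ := by
  unfold rPlus
  nlinarith [Real.sqrt_nonneg (1 - χ ^ 2)]

theorem integrableOn_density (hM : 0 < M) :
    IntegrableOn (fun p : ℝ × ℝ × ℝ => (p.1 - M) * (pontryaginDensity M χ p.1 p.2.1 * cos p.2.1))
      (slice M χ) := by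
  -- The factor `1` is the function of the angles in the product form that `Integrable.mul_prod`
  -- expects.
  have hdom : IntegrableOn (fun p : ℝ × ℝ × ℝ => 864 * M ^ 2 * |M * χ| * p.1 ^ (-4 : ℝ) * 1)
      (slice M χ) := by
    rw [IntegrableOn, Measure.volume_eq_prod, slice, ← Measure.prod_restrict]
    refine Integrable.mul_prod (f := fun r : ℝ => 864 * M ^ 2 * |M * χ| * r ^ (-4 : ℝ))
      (g := fun _ : ℝ × ℝ => (1 : ℝ)) ?_ ?_
    · exact (integrableOn_Ioi_rpow_of_lt (by norm_num) (rPlus_pos hM)).const_mul _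
    · rw [Measure.volume_eq_prod, ← Measure.prod_restrict]
      exact integrable_const _
  refine Integrable.mono' hdom ?_ ?_
  · refine Measurable.aestronglyMeasurable ?_
    unfold pontryaginDensity kerrSigma
    fun_prop
  · refine (ae_restrict_mem (measurableSet_slice M χ)).mono fun p hp => ?_
    rw [mul_one, Real.norm_eq_abs]
    exact abs_pontryaginDensity_le hM ((le_rPlus hM).trans hp.1.le)

theorem integrableOn_hairIntegrand (hM : 0 < M) (hχ : |χ| ≤ 1) :
    IntegrableOn (hairIntegrand M χ) (slice M χ) :=
  (integrableOn_density hM).congr_fun (fun _ hp => (hairIntegrand_eq hM hχ hp).symm)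
    (measurableSet_slice M χ)

theorem integral_hairIntegrand (hM : 0 < M) (hχ : |χ| ≤ 1) :
    ∫ p in slice M χ, hairIntegrand M χ p = -(2 * π) * tailPrimitive M χ (rPlus M χ)⁻¹ := by
  have hpos := rPlus_pos (χ := χ) hM
  have hint := integrableOn_density (χ := χ) hM
  rw [setIntegral_congr_fun (measurableSet_slice M χ) fun p hp => hairIntegrand_eq hM hχ hp]
  have inner : ∀ r ∈ Ioi (rPlus M χ), ∫ q in Ioo 0 π ×ˢ Ioo 0 (2 * π),
      (r - M) * (pontryaginDensity M χ r q.1 * cos q.1) =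
      2 * π * ((r - M) * angularDensity M χ r) := by
    intro r hr
    have h := setIntegral_prod_mul (μ := volume) (ν := volume)
      (fun θ => (r - M) * (pontryaginDensity M χ r θ * cos θ)) (fun _ : ℝ => (1 : ℝ))
      (Ioo 0 π) (Ioo 0 (2 * π))
    simp only [mul_one] at h
    rw [Measure.volume_eq_prod, h, integral_const_mul, ← integral_Ioc_eq_integral_Ioo,
      ← intervalIntegral.integral_of_le pi_pos.le,
      integral_pontryaginDensity_mul_cos (hpos.trans hr)]
    simp [pi_pos.le]
    ring
  rw [slice, Measure.volume_eq_prod] at hint ⊢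
  rw [setIntegral_prod _ hint, setIntegral_congr_fun measurableSet_Ioi inner, integral_const_mul]
  have hI : IntegrableOn (fun r => (r - M) * angularDensity M χ r) (Ioi (rPlus M χ)) := by
    rw [IntegrableOn, ← Measure.prod_restrict] at hint
    have h2 := (IntegrableOn.congr_fun hint.integral_prod_left inner measurableSet_Ioi).const_mul
      (2 * π)⁻¹
    refine h2.congr (Eventually.of_forall fun r => ?_)
    simp only
    rw [inv_mul_cancel_left₀ (by positivity)]
  have hT : Tendsto (fun r => tailPrimitive M χ r⁻¹) atTop (𝓝 0) := by
    have h := (hasDerivAt_tailPrimitive M χ 0).continuousAt.tendsto.comp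
      (tendsto_inv_atTop_zero (𝕜 := ℝ))
    have h0 : tailPrimitive M χ 0 = 0 := by simp [tailPrimitive]
    rwa [h0] at h
  rw [integral_Ioi_of_hasDerivAt_of_tendsto
    (hasDerivAt_tailPrimitive_inv hpos).continuousAt.continuousWithinAt
    (fun r hr => hasDerivAt_tailPrimitive_inv (hpos.trans hr)) hI hT]
  ring

end DCS

namespace DCS

/-! ### Families depending smoothly on the coupling -/

/-- `f ε y` is smooth in `(ε, y)` at `(0, x)`. -/
def SmoothFamilyAt (f : ℝ → Coord → ℝ) (x : Coord) : Prop :=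
  ContDiffAt ℝ ∞ (fun p : ℝ × Coord => f p.1 p.2) (0, x)

theorem two_le_infty : (2 : WithTop ℕ∞) ≤ ∞ :=
  WithTop.coe_le_coe.2 (le_top : (2 : ℕ∞) ≤ ⊤)

/-- The first-order coefficient of a family in the coupling. -/
def couplingDeriv (f : ℝ → Coord → ℝ) (x : Coord) : ℝ := deriv (fun ε => f ε x) 0

theorem pd_eq_fderiv {F : ℝ × Coord → ℝ} {ε : ℝ} {x : Coord} (i : Fin 4)
    (h : DifferentiableAt ℝ F (ε, x)) :
    pd i (fun y => F (ε, y)) x = fderiv ℝ F (ε, x) (0, Pi.single i 1) := by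
  have h1 : HasDerivAt (fun s => ((ε, Function.update x i s) : ℝ × Coord)) (0, Pi.single i 1)
      (x i) := (hasDerivAt_const _ _).prodMk (hasDerivAt_update x i (x i))
  have h2 : HasFDerivAt F (fderiv ℝ F (ε, x)) (ε, Function.update x i (x i)) := by
    rw [Function.update_eq_self]; exact h.hasFDerivAt
  exact (h2.comp_hasDerivAt (x i) h1).deriv

theorem deriv_eq_fderiv {F : ℝ × Coord → ℝ} {ε : ℝ} {x : Coord}
    (h : DifferentiableAt ℝ F (ε, x)) :
    deriv (fun e => F (e, x)) ε = fderiv ℝ F (ε, x) (1, 0) :=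
  (h.hasFDerivAt.comp_hasDerivAt ε ((hasDerivAt_id' ε).prodMk (hasDerivAt_const ε x))).deriv

variable {f : ℝ → Coord → ℝ} {x : Coord}

namespace SmoothFamilyAt

theorem pd (h : SmoothFamilyAt f x) (i : Fin 4) : SmoothFamilyAt (fun ε => DCS.pd i (f ε)) x := by
  have h1 : ∀ᶠ p in 𝓝 ((0 : ℝ), x), ContDiffAt ℝ 1 (fun p : ℝ × Coord => f p.1 p.2) p :=
    (h.of_le (by exact_mod_cast le_top)).eventually (by simp)
  have h2 : ContDiffAt ℝ ∞
      (fun p => fderiv ℝ (fun p : ℝ × Coord => f p.1 p.2) p (0, Pi.single i 1)) (0, x) :=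
    (h.fderiv_right (m := ∞) (by exact_mod_cast le_top)).clm_apply contDiffAt_const
  refine h2.congr_of_eventuallyEq (h1.mono fun p hp => ?_)
  exact pd_eq_fderiv i (hp.differentiableAt (by simp))

theorem contDiffAt_coupling (h : SmoothFamilyAt f x) : ContDiffAt ℝ ∞ (fun ε => f ε x) 0 :=
  ContDiffAt.comp (g := fun p : ℝ × Coord => f p.1 p.2) (f := fun ε => (ε, x)) (0 : ℝ) h
    (contDiffAt_id.prodMk contDiffAt_const)

theorem hasDerivAt (h : SmoothFamilyAt f x) :
    HasDerivAt (fun ε => f ε x) (couplingDeriv f x) 0 :=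
  (h.contDiffAt_coupling.differentiableAt (by simp)).hasDerivAt

theorem continuousAt (h : SmoothFamilyAt f x) : ContinuousAt (fun ε => f ε x) 0 :=
  h.contDiffAt_coupling.continuousAt

theorem eventually_contDiffAt (h : SmoothFamilyAt f x) :
    ∀ᶠ y in 𝓝 x, ContDiffAt ℝ 2 (fun p : ℝ × Coord => f p.1 p.2) (0, y) := by
  have h1 := (h.of_le two_le_infty).eventually (by simp)
  exact (Continuous.prodMk_right (0 : ℝ)).continuousAt.eventually h1

end SmoothFamilyAt

/-- The coupling derivative commutes with `∂_i` by symmetry of the second derivative of the jointly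
`C²` function. -/
theorem hasDerivAt_pd (h : ContDiffAt ℝ 2 (fun p : ℝ × Coord => f p.1 p.2) (0, x)) (i : Fin 4) :
    HasDerivAt (fun ε => pd i (f ε) x) (pd i (couplingDeriv f) x) 0 := by
  set F := fun p : ℝ × Coord => f p.1 p.2 with hF
  have h1 : ∀ᶠ p in 𝓝 ((0 : ℝ), x), DifferentiableAt ℝ F p :=
    (h.eventually (by simp)).mono fun p hp => hp.differentiableAt (by simp)
  have h2 : DifferentiableAt ℝ (fderiv ℝ F) (0, x) :=
    (h.fderiv_right (m := 1) (by norm_num)).differentiableAt (by simp)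
  have h3 : HasDerivAt (fun ε : ℝ => fderiv ℝ F (ε, x))
      (fderiv ℝ (fderiv ℝ F) (0, x) (1, 0)) 0 :=
    h2.hasFDerivAt.comp_hasDerivAt (0 : ℝ) ((hasDerivAt_id' 0).prodMk (hasDerivAt_const _ x))
  have h4 : HasDerivAt (fun ε : ℝ => fderiv ℝ F (ε, x) (0, Pi.single i 1))
      (fderiv ℝ (fderiv ℝ F) (0, x) (1, 0) (0, Pi.single i 1)) 0 := by
    simpa using h3.clm_apply (hasDerivAt_const (0 : ℝ) ((0 : ℝ), (Pi.single i 1 : Coord)))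
  have e1 : (fun ε => pd i (f ε) x) =ᶠ[𝓝 0] fun ε => fderiv ℝ F (ε, x) (0, Pi.single i 1) :=
    ((Continuous.prodMk_left x).continuousAt.eventually h1).mono fun ε hε => pd_eq_fderiv i hε
  have e2 : couplingDeriv f =ᶠ[𝓝 x] fun y => fderiv ℝ F (0, y) (1, 0) :=
    ((Continuous.prodMk_right (0 : ℝ)).continuousAt.eventually h1).mono fun y hy =>
      deriv_eq_fderiv hy
  have e3 : pd i (fun y => fderiv ℝ F (0, y) (1, 0)) x =
      fderiv ℝ (fderiv ℝ F) (0, x) (0, Pi.single i 1) (1, 0) := by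
    rw [pd_eq_fderiv (F := fun p => fderiv ℝ F p (1, 0)) i
      (h2.clm_apply (differentiableAt_const _)), fderiv_clm_apply h2 (differentiableAt_const _)]
    simp
  have hsymm : IsSymmSndFDerivAt ℝ F (0, x) := h.isSymmSndFDerivAt (by simp)
  rw [pd_congr i e2, e3, hsymm.eq]
  exact h4.congr_of_eventuallyEq e1

theorem SmoothFamilyAt.hasDerivAt_pd_pd (h : SmoothFamilyAt f x) (i j : Fin 4) :
    HasDerivAt (fun ε => DCS.pd i (DCS.pd j (f ε)) x)
      (DCS.pd i (DCS.pd j (couplingDeriv f)) x) 0 := by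
  have h1 := hasDerivAt_pd (f := fun ε => DCS.pd j (f ε)) ((h.pd j).of_le two_le_infty) i
  have h2 : couplingDeriv (fun ε => DCS.pd j (f ε)) =ᶠ[𝓝 x] DCS.pd j (couplingDeriv f) :=
    h.eventually_contDiffAt.mono fun y hy => (hasDerivAt_pd hy j).deriv
  rwa [pd_congr i h2] at h1

/-! ### Linearization of the wave operator and of the source -/

/-- A family of metrics that is smooth at `(0, x)` and Lorentzian there. -/
structure SmoothMetricAt (g : ℝ → Metric) (x : Coord) : Prop where
  smooth : ∀ i j, SmoothFamilyAt (fun ε y => g ε y i j) x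
  det_neg : (g 0 x).det < 0

namespace SmoothMetricAt

variable {g : ℝ → Metric}

theorem det (h : SmoothMetricAt g x) : SmoothFamilyAt (fun ε y => (g ε y).det) x := by
  simp only [SmoothFamilyAt, Matrix.det_apply']
  exact ContDiffAt.sum fun σ _ => contDiffAt_const.mul (contDiffAt_prod fun i _ => h.smooth _ _)

theorem inv (h : SmoothMetricAt g x) (i j : Fin 4) :
    SmoothFamilyAt (fun ε y => (g ε y)⁻¹ i j) x := by
  have h1 : SmoothFamilyAt (fun ε y => (g ε y).adjugate i j) x := by
    simp only [SmoothFamilyAt, Matrix.adjugate_apply, Matrix.det_apply']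
    refine ContDiffAt.sum fun σ _ => contDiffAt_const.mul (contDiffAt_prod fun k _ => ?_)
    simp only [Matrix.updateRow_apply]
    split_ifs
    · exact contDiffAt_const
    · exact h.smooth _ _
  have h2 : SmoothFamilyAt (fun ε y => (g ε y).det⁻¹ * (g ε y).adjugate i j) x :=
    (ContDiffAt.inv h.det h.det_neg.ne).mul h1
  simpa only [SmoothFamilyAt, Matrix.inv_def, Matrix.smul_apply, Ring.inverse_eq_inv',
    smul_eq_mul] using h2

theorem christoffel (h : SmoothMetricAt g x) (i j k : Fin 4) :
    SmoothFamilyAt (fun ε => DCS.christoffel (g ε) i j k) x := by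
  unfold SmoothFamilyAt DCS.christoffel
  exact contDiffAt_const.mul (ContDiffAt.sum fun d _ => (h.inv i d).mul
    ((((h.smooth d k).pd j).add ((h.smooth d j).pd k)).sub ((h.smooth j k).pd d)))

theorem riemann (h : SmoothMetricAt g x) (i j k l : Fin 4) :
    SmoothFamilyAt (fun ε => DCS.riemann (g ε) i j k l) x := by
  unfold SmoothFamilyAt DCS.riemann
  exact (((h.christoffel i j l).pd k).sub ((h.christoffel i j k).pd l)).add
    (ContDiffAt.sum fun e _ => ((h.christoffel i k e).mul (h.christoffel e j l)).sub
      ((h.christoffel i l e).mul (h.christoffel e j k)))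

theorem continuousAt_pontryagin (h : SmoothMetricAt g x) :
    ContinuousAt (fun ε => pontryagin (g ε) x) 0 := by
  have hR := fun i j k l => (h.riemann i j k l).continuousAt
  have hs : ContinuousAt (fun ε => sqrtNegDet (g ε) x) 0 := h.det.continuousAt.neg.sqrt
  have hs0 : sqrtNegDet (g 0) x ≠ 0 := (Real.sqrt_pos.2 (neg_pos.2 h.det_neg)).ne'
  simp only [pontryagin_eq_sum]
  refine (continuousAt_const.div hs hs0).neg.mul (tendsto_finsetSum _ fun a _ =>
    tendsto_finsetSum _ fun b _ => ?_)
  exact (((hR _ _ _ _).mul (hR _ _ _ _)).sub ((hR _ _ _ _).mul (hR _ _ _ _))).add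
    ((hR _ _ _ _).mul (hR _ _ _ _))

/-- In the product rule every variation of the metric multiplies a derivative of `f 0`, which
vanishes near `x`. Only the variation of the scalar survives. -/
theorem hasDerivAt_box (h : SmoothMetricAt g x) (hf : SmoothFamilyAt f x) (h0 : f 0 =ᶠ[𝓝 x] 0) :
    HasDerivAt (fun ε => box (g ε) (f ε) x) (box (g 0) (couplingDeriv f) x) 0 := by
  have z1 : ∀ i, pd i (0 : Coord → ℝ) = 0 := fun i => funext fun y => by simp [pd]
  have z2 : ∀ i, pd i (f 0) x = 0 := fun i => by rw [pd_congr i h0, z1]; rfl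
  have z3 : ∀ i j, pd i (pd j (f 0)) x = 0 := fun i j => by
    rw [pd_congr i (pd_congr_nhds j h0), z1, z1]; rfl
  unfold box
  refine HasDerivAt.fun_sum fun a _ => HasDerivAt.fun_sum fun b _ => ?_
  have h1 : HasDerivAt (fun ε => ∑ c, DCS.christoffel (g ε) c a b x * pd c (f ε) x)
      (∑ c, DCS.christoffel (g 0) c a b x * pd c (couplingDeriv f) x) 0 := by
    refine HasDerivAt.fun_sum fun c _ => ?_
    refine ((h.christoffel c a b).hasDerivAt.fun_mul
      (hasDerivAt_pd (hf.of_le two_le_infty) c)).congr_deriv ?_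
    rw [z2]; ring
  refine ((h.inv a b).hasDerivAt.fun_mul ((hf.hasDerivAt_pd_pd a b).fun_sub h1)).congr_deriv ?_
  simp only [z2, z3, mul_zero, Finset.sum_const_zero, sub_zero, zero_add]

/-- The scalar field equation at first order in the coupling. -/
theorem box_couplingDeriv (h : SmoothMetricAt g x) (hf : SmoothFamilyAt f x)
    (h0 : f 0 =ᶠ[𝓝 x] 0)
    (heq : ∀ᶠ ε in 𝓝 0, box (g ε) (f ε) x + ε * pontryagin (g ε) x = 0) :
    box (g 0) (couplingDeriv f) x = -pontryagin (g 0) x := by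
  -- The explicit factor `ε` makes the difference quotient at `0` equal to the density itself, so
  -- continuity of the density in `ε` suffices.
  have h1 : HasDerivAt (fun ε => ε * pontryagin (g ε) x) (pontryagin (g 0) x) 0 := by
    rw [hasDerivAt_iff_tendsto_slope]
    refine (h.continuousAt_pontryagin.tendsto.mono_left nhdsWithin_le_nhds).congr' ?_
    filter_upwards [self_mem_nhdsWithin] with ε hε
    rw [slope_def_field]
    field_simp [show ε ≠ 0 from hε]
    simp
  have h2 := ((h.hasDerivAt_box hf h0).fun_add h1).congr_of_eventuallyEq
    (heq.mono fun ε hε => hε.symm :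
      (fun _ => (0 : ℝ)) =ᶠ[𝓝 0] fun ε => box (g ε) (f ε) x + ε * pontryagin (g ε) x)
  linarith [h2.unique (hasDerivAt_const (0 : ℝ) (0 : ℝ))]

end SmoothMetricAt

end DCS

namespace DCS

/-! ### Auxiliary analysis -/

/-- Differentiation under the integral sign over a compact interval. -/
theorem hasDerivAt_intervalIntegral {f f' : ℝ → ℝ → ℝ} {I : Set ℝ} {a b s : ℝ} (hab : a ≤ b)
    (hI : I ∈ 𝓝 s) (hf : ∀ s ∈ I, ContinuousOn (f s) (Icc a b))
    (hf' : ContinuousOn (fun p : ℝ × ℝ => f' p.1 p.2) (I ×ˢ Icc a b))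
    (hd : ∀ s ∈ I, ∀ θ ∈ Icc a b, HasDerivAt (fun s => f s θ) (f' s θ) s) :
    HasDerivAt (fun s => ∫ θ in a..b, f s θ) (∫ θ in a..b, f' s θ) s := by
  -- Compactness of `K ×ˢ Icc a b` supplies a constant as the dominating function.
  obtain ⟨K, hK, hKI, hKc⟩ := local_compact_nhds hI
  obtain ⟨C, hC⟩ := ((hKc.prod isCompact_Icc).image_of_continuousOn
    (hf'.mono (prod_mono hKI Subset.rfl))).isBounded.exists_norm_le
  have hΙ : uIoc a b ⊆ Icc a b := by rw [uIoc_of_le hab]; exact Ioc_subset_Icc_self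
  have hsI := mem_of_mem_nhds hI
  have hfi : ∀ g : ℝ → ℝ, ContinuousOn g (Icc a b) → IntervalIntegrable g volume a b :=
    fun g hg => ContinuousOn.intervalIntegrable (by rwa [uIcc_of_le hab])
  have hm : ∀ g : ℝ → ℝ, ContinuousOn g (Icc a b) →
      AEStronglyMeasurable g (volume.restrict (uIoc a b)) := fun g hg =>
    (intervalIntegrable_iff.1 (hfi g hg)).aestronglyMeasurable
  have hf's : ContinuousOn (f' s) (Icc a b) :=
    hf'.comp (by fun_prop : Continuous fun θ : ℝ => (s, θ)).continuousOn fun θ hθ => ⟨hsI, hθ⟩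
  refine (intervalIntegral.hasDerivAt_integral_of_dominated_loc_of_deriv_le
    (bound := fun _ => C) hK ?_ (hfi _ (hf s hsI)) (hm _ hf's) ?_ ?_ ?_).2
  · filter_upwards [hI] with s hs using hm _ (hf s hs)
  · exact Eventually.of_forall fun θ hθ s hs => hC _ ⟨(s, θ), ⟨hs, hΙ hθ⟩, rfl⟩
  · exact intervalIntegrable_const
  · exact Eventually.of_forall fun θ hθ s hs => hd s (hKI hs) θ (hΙ hθ)

/-- The second-order Taylor formula with the Peano remainder, at `0`. -/
theorem tendsto_taylor_two {f f1 : ℝ → ℝ} {f2 : ℝ} (h1 : ∀ᶠ s in 𝓝 0, HasDerivAt f (f1 s) s)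
    (h2 : HasDerivAt f1 f2 0) :
    Tendsto (fun s => (f s - f 0 - f1 0 * s) / s ^ 2) (𝓝[≠] 0) (𝓝 (f2 / 2)) := by
  refine HasDerivAt.lhopital_zero_nhdsNE (f' := fun s => f1 s - f1 0) (g' := fun s => 2 * s)
    ?_ ?_ ?_ ?_ ?_ ?_
  · filter_upwards [nhdsWithin_le_nhds h1] with s hs
    simpa using (hs.sub_const (f 0)).fun_sub ((hasDerivAt_id' s).const_mul (f1 0))
  · exact Eventually.of_forall fun s => by simpa using hasDerivAt_pow 2 s
  · filter_upwards [self_mem_nhdsWithin] with s hs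
    exact mul_ne_zero two_ne_zero hs
  · have hc : ContinuousAt (fun s => f s - f 0 - f1 0 * s) 0 :=
      (h1.self_of_nhds.continuousAt.sub continuousAt_const).sub
        (continuousAt_const.mul continuousAt_id)
    have := hc.tendsto
    simp only [sub_self, mul_zero] at this
    exact this.mono_left nhdsWithin_le_nhds
  · have hc : ContinuousAt (fun s : ℝ => s ^ 2) 0 := by fun_prop
    have := hc.tendsto
    simp only [ne_eq, OfNat.ofNat_ne_zero, not_false_eq_true, zero_pow] at this
    exact this.mono_left nhdsWithin_le_nhds
  · have := (hasDerivAt_iff_tendsto_slope.1 h2).div_const 2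
    refine this.congr' ?_
    filter_upwards [self_mem_nhdsWithin] with s hs
    rw [slope_def_field, sub_zero, div_div, mul_comm]

/-- A second derivative at the single point `0` is enough, by the Peano form of Taylor's formula.
The punctured neighbourhood is then completed with the trivial value at `0`. -/
theorem isBigO_sub_linear {f f1 : ℝ → ℝ} {f2 : ℝ} (h1 : ∀ᶠ s in 𝓝 0, HasDerivAt f (f1 s) s)
    (h2 : HasDerivAt f1 f2 0) (h0 : f 0 = 0) :
    (fun s => f s - f1 0 * s) =O[𝓝 0] fun s => s ^ 2 := by
  have h := tendsto_taylor_two h1 h2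
  rw [h0] at h
  have h3 : (fun s => f s - f1 0 * s) =O[𝓝[≠] 0] fun s => s ^ 2 := by
    refine Asymptotics.isBigO_of_div_tendsto_nhds ?_ (f2 / 2)
      (by simp only [sub_zero] at h; exact h)
    filter_upwards [self_mem_nhdsWithin] with s hs hs2
    exact absurd (pow_eq_zero_iff two_ne_zero |>.1 hs2) hs
  obtain ⟨C, hC⟩ := h3.bound
  refine IsBigO.of_bound C ?_
  rw [eventually_nhdsWithin_iff] at hC
  filter_upwards [hC] with s hs
  by_cases hs0 : s = 0
  · subst hs0; simp [h0]
  · exact hs hs0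

/-- The coefficients of an expansion `f(1/r) = m₁/r + m₂/r² + O(r⁻³)` of a twice differentiable
function. -/
theorem expansion_coeff {f f1 : ℝ → ℝ} {f2 m₁ m₂ : ℝ} (h1 : ∀ᶠ s in 𝓝 0, HasDerivAt f (f1 s) s)
    (h2 : HasDerivAt f1 f2 0)
    (h : (fun r => f (1 / r) - m₁ / r - m₂ / r ^ 2) =O[atTop] fun r : ℝ => 1 / r ^ 3) :
    f 0 = 0 ∧ m₂ = f2 / 2 := by
  -- After `s = 1/r` the remainder is `O(s³)` as `s → 0⁺`; dividing it by `1`, `s` and `s²` in turn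
  -- identifies the three Taylor coefficients.
  have hO : (fun s => f s - m₁ * s - m₂ * s ^ 2) =O[𝓝[>] 0] fun s : ℝ => s ^ 3 := by
    refine (h.comp_tendsto tendsto_inv_nhdsGT_zero).congr (fun s => ?_) fun s => ?_ <;>
      simp [div_eq_mul_inv]
  have hlim : ∀ n : ℕ, n < 3 →
      Tendsto (fun s => (f s - m₁ * s - m₂ * s ^ 2) / s ^ n) (𝓝[>] 0) (𝓝 0) := by
    intro n hn
    have ho : (fun s : ℝ => s ^ 3) =o[𝓝[>] 0] fun s : ℝ => s ^ n :=
      (isLittleO_pow_pow hn).mono nhdsWithin_le_nhds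
    exact (hO.trans_isLittleO ho).tendsto_div_nhds_zero
  have hid : Tendsto (fun s : ℝ => s) (𝓝[>] 0) (𝓝 0) := nhdsWithin_le_nhds
  have hgt : 𝓝[>] (0 : ℝ) ≤ 𝓝[≠] 0 := nhdsWithin_mono 0 fun s hs => ne_of_gt hs
  have hf : Tendsto f (𝓝[>] 0) (𝓝 (f 0)) :=
    h1.self_of_nhds.continuousAt.tendsto.mono_left nhdsWithin_le_nhds
  have e0 : f 0 = 0 := by
    have h3 := (((hlim 0 (by norm_num)).add (hid.const_mul m₁)).add ((hid.pow 2).const_mul m₂))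
    refine tendsto_nhds_unique hf ((?_ : Tendsto (fun s => f s - m₁ * s - m₂ * s ^ 2 + m₁ * s
      + m₂ * s ^ 2) (𝓝[>] 0) (𝓝 0)).congr fun s => by ring)
    simpa using h3
  have hsl : Tendsto (fun s => f s / s) (𝓝[>] 0) (𝓝 (f1 0)) := by
    have := (hasDerivAt_iff_tendsto_slope.1 h1.self_of_nhds).mono_left hgt
    simpa [slope_def_field, e0, slope_fun_def_field] using this
  have e1 : f1 0 = m₁ := by
    have h3 := ((hlim 1 (by norm_num)).add_const m₁).add (hid.const_mul m₂)
    refine tendsto_nhds_unique hsl ?_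
    simp only [zero_add, mul_zero, add_zero] at h3
    refine h3.congr' ?_
    filter_upwards [self_mem_nhdsWithin] with s hs
    have : s ≠ 0 := ne_of_gt hs
    field_simp
    ring
  have hq := (tendsto_taylor_two h1 h2).mono_left hgt
  have h3 := (hlim 2 (by norm_num)).add_const m₂
  rw [zero_add] at h3
  refine ⟨e0, tendsto_nhds_unique h3 (hq.congr' ?_)⟩
  filter_upwards [self_mem_nhdsWithin] with s hs
  have : s ≠ 0 := ne_of_gt hs
  rw [e0, e1]
  field_simp
  ring

/-! ### Functions on a strip -/

/-- The functions `u1`, `u11`, `u2`, `u22` are the derivatives `∂ₛu`, `∂ₛ²u`, `∂_θu`, `∂_θ²u` of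
`u s θ`, and all are continuous, for `s` in the open set `I` and `θ ∈ [0, π]`. -/
structure StripDerivs (I : Set ℝ) (u u1 u11 u2 u22 : ℝ → ℝ → ℝ) : Prop where
  isOpen : IsOpen I
  d1 : ∀ s ∈ I, ∀ θ ∈ Icc 0 π, HasDerivAt (fun s => u s θ) (u1 s θ) s
  d11 : ∀ s ∈ I, ∀ θ ∈ Icc 0 π, HasDerivAt (fun s => u1 s θ) (u11 s θ) s
  d2 : ∀ s ∈ I, ∀ θ ∈ Icc 0 π, HasDerivAt (u s) (u2 s θ) θ
  d22 : ∀ s ∈ I, ∀ θ ∈ Icc 0 π, HasDerivAt (u2 s) (u22 s θ) θ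
  c : ContinuousOn (fun p : ℝ × ℝ => u p.1 p.2) (I ×ˢ Icc 0 π)
  c1 : ContinuousOn (fun p : ℝ × ℝ => u1 p.1 p.2) (I ×ˢ Icc 0 π)
  c11 : ContinuousOn (fun p : ℝ × ℝ => u11 p.1 p.2) (I ×ˢ Icc 0 π)
  c2 : ContinuousOn (fun p : ℝ × ℝ => u2 p.1 p.2) (I ×ˢ Icc 0 π)
  c22 : ContinuousOn (fun p : ℝ × ℝ => u22 p.1 p.2) (I ×ˢ Icc 0 π)

theorem continuousOn_slice {f : ℝ → ℝ → ℝ} {I J : Set ℝ} {s : ℝ}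
    (h : ContinuousOn (fun p : ℝ × ℝ => f p.1 p.2) (I ×ˢ J)) (hs : s ∈ I) :
    ContinuousOn (f s) J :=
  h.comp (by fun_prop : Continuous fun θ : ℝ => (s, θ)).continuousOn fun _ hθ => ⟨hs, hθ⟩

theorem intervalIntegrable_of_Icc {f : ℝ → ℝ} (h : ContinuousOn f (Icc 0 π)) :
    IntervalIntegrable f volume 0 π :=
  ContinuousOn.intervalIntegrable (by rwa [uIcc_of_le pi_pos.le])

/-! ### The Kerr wave equation in `s = 1/r`, and the absence of regular hair -/

/-- `s² Δ(1/s)` on Kerr. -/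
def radialCoeff (M χ s : ℝ) : ℝ := 1 - 2 * M * s + (M * χ) ^ 2 * s ^ 2

/-- The derivative of `radialCoeff`. -/
def radialCoeffDeriv (M χ s : ℝ) : ℝ := -2 * M + 2 * (M * χ) ^ 2 * s

theorem hasDerivAt_radialCoeff (M χ s : ℝ) :
    HasDerivAt (radialCoeff M χ) (radialCoeffDeriv M χ s) s := by
  have hid := hasDerivAt_id' s
  refine (((hid.const_mul (2 * M)).const_sub 1).fun_add
    ((hid.fun_pow 2).const_mul ((M * χ) ^ 2))).congr_deriv ?_
  simp [radialCoeffDeriv]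
  ring

variable {M χ : ℝ}

theorem radialCoeff_eq {s : ℝ} (hs : s ≠ 0) : radialCoeff M χ s = s ^ 2 * kerrDelta M χ s⁻¹ := by
  unfold radialCoeff kerrDelta
  field_simp

theorem radialCoeff_pos (hM : 0 < M) (hχ : |χ| ≤ 1) {s : ℝ} (hs : s ∈ Ioo 0 (rPlus M χ)⁻¹) :
    0 < radialCoeff M χ s := by
  rw [radialCoeff_eq hs.1.ne']
  have := kerrDelta_pos hM hχ ((lt_inv_comm₀ hs.1 (rPlus_pos hM)).1 hs.2)
  have := hs.1
  positivity

theorem radialCoeff_horizon (hM : 0 < M) (hχ : |χ| ≤ 1) : radialCoeff M χ (rPlus M χ)⁻¹ = 0 := by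
  rw [radialCoeff_eq (inv_pos.2 (rPlus_pos hM)).ne', inv_inv, kerrDelta_eq hχ]
  simp

/-- The wave equation `Σ sin θ □u = -ρ` on the Kerr exterior, in the coordinates `s = 1/r`, `θ`. -/
def WaveEq (M χ : ℝ) (u1 u11 u2 u22 ρ : ℝ → ℝ → ℝ) : Prop :=
  ∀ s ∈ Ioo 0 (rPlus M χ)⁻¹, ∀ θ ∈ Ioo 0 π,
    sin θ * (s ^ 2 * (radialCoeff M χ s * u11 s θ + radialCoeffDeriv M χ s * u1 s θ) + u22 s θ)
      + cos θ * u2 s θ = -ρ s θ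

variable {I : Set ℝ} {u u1 u11 u2 u22 : ℝ → ℝ → ℝ}

/-- An energy argument for `e(s) = ∫ sin θ u²`. The equation makes `radialCoeff · e'` nondecreasing,
and this flux is zero at the horizon, so `e' ≤ 0` on the exterior. As `e` starts from `0` at
infinity and is nonnegative, it vanishes. Only the vanishing of `radialCoeff` at the horizon enters,
not its order, so the extremal case is included. -/
theorem StripDerivs.eq_zero (hM : 0 < M) (hχ : |χ| ≤ 1) (h : StripDerivs I u u1 u11 u2 u22)
    (hI : Icc 0 (rPlus M χ)⁻¹ ⊆ I) (hw : WaveEq M χ u1 u11 u2 u22 0)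
    (h0 : ∀ θ ∈ Icc 0 π, u 0 θ = 0) {s θ : ℝ} (hs : s ∈ Ioo 0 (rPlus M χ)⁻¹) (hθ : θ ∈ Icc 0 π)  :
    sin θ * u s θ ^ 2 = 0 := by
  have hs0 : 0 < (rPlus M χ)⁻¹ := inv_pos.2 (rPlus_pos hM)
  set s0 := (rPlus M χ)⁻¹ with hs0def
  have hsin : Continuous fun p : ℝ × ℝ => sin p.2 := by fun_prop
  set e : ℝ → ℝ := fun s => ∫ θ in (0 : ℝ)..π, sin θ * u s θ ^ 2 with he
  set e1 : ℝ → ℝ := fun s => ∫ θ in (0 : ℝ)..π, 2 * sin θ * (u s θ * u1 s θ) with he1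
  set e11 : ℝ → ℝ := fun s => ∫ θ in (0 : ℝ)..π, 2 * sin θ * (u1 s θ ^ 2 + u s θ * u11 s θ)
    with he11
  have cc := fun s (hs : s ∈ I) => continuousOn_slice h.c hs
  have cc1 := fun s (hs : s ∈ I) => continuousOn_slice h.c1 hs
  have cc11 := fun s (hs : s ∈ I) => continuousOn_slice h.c11 hs
  have cc2 := fun s (hs : s ∈ I) => continuousOn_slice h.c2 hs
  have cc22 := fun s (hs : s ∈ I) => continuousOn_slice h.c22 hs
  have de : ∀ s ∈ I, HasDerivAt e (e1 s) s := fun s hs => by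
    refine hasDerivAt_intervalIntegral (f := fun s θ => sin θ * u s θ ^ 2)
      (f' := fun s θ => 2 * sin θ * (u s θ * u1 s θ)) pi_pos.le (h.isOpen.mem_nhds hs)
      (fun s hs => continuousOn_sin.mul ((cc s hs).pow 2)) ?_ fun s hs θ hθ => ?_
    · exact (hsin.const_mul 2).continuousOn.mul (h.c.mul h.c1)
    · exact (((h.d1 s hs θ hθ).fun_pow 2).const_mul (sin θ)).congr_deriv (by simp; ring)
  have de1 : ∀ s ∈ I, HasDerivAt e1 (e11 s) s := fun s hs => by
    refine hasDerivAt_intervalIntegral (f := fun s θ => 2 * sin θ * (u s θ * u1 s θ))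
      (f' := fun s θ => 2 * sin θ * (u1 s θ ^ 2 + u s θ * u11 s θ)) pi_pos.le
      (h.isOpen.mem_nhds hs)
      (fun s hs => (continuousOn_sin.const_mul 2).mul ((cc s hs).mul (cc1 s hs))) ?_
      fun s hs θ hθ => ?_
    · exact (hsin.const_mul 2).continuousOn.mul ((h.c1.pow 2).add (h.c.mul h.c11))
    · exact (((h.d1 s hs θ hθ).fun_mul (h.d11 s hs θ hθ)).const_mul (2 * sin θ)).congr_deriv
        (by ring)
  have hflux : ∀ s ∈ Ioo 0 s0,
      0 ≤ radialCoeffDeriv M χ s * e1 s + radialCoeff M χ s * e11 s := by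
    intro s hs
    have hsI : s ∈ I := hI (Ioo_subset_Icc_self hs)
    have hD := radialCoeff_pos hM hχ hs
    -- The integrand is the derivative of `u sin θ ∂_θ u`, which vanishes at both poles.
    have b0 : ∫ θ in (0 : ℝ)..π, (sin θ * u2 s θ ^ 2
        + u s θ * (sin θ * u22 s θ + cos θ * u2 s θ)) = 0 := by
      rw [intervalIntegral.integral_eq_sub_of_hasDerivAt
        (f := fun θ => u s θ * (sin θ * u2 s θ))]
      · simp
      · intro θ hθ
        rw [uIcc_of_le pi_pos.le] at hθ
        exact ((h.d2 s hsI θ hθ).fun_mul ((hasDerivAt_sin θ).fun_mul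
          (h.d22 s hsI θ hθ))).congr_deriv
          (by ring)
      · exact intervalIntegrable_of_Icc ((continuousOn_sin.mul ((cc2 s hsI).pow 2)).add
          ((cc s hsI).mul ((continuousOn_sin.mul (cc22 s hsI)).add
            (continuousOn_cos.mul (cc2 s hsI)))))
    -- By the wave equation the flux derivative is a sum of squares minus twice the integrand of
    -- `b0`.
    have b1 : s ^ 2 * (radialCoeffDeriv M χ s * e1 s + radialCoeff M χ s * e11 s) =
        ∫ θ in (0 : ℝ)..π, (2 * sin θ * (s ^ 2 * radialCoeff M χ s * u1 s θ ^ 2 + u2 s θ ^ 2)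
          - 2 * (sin θ * u2 s θ ^ 2 + u s θ * (sin θ * u22 s θ + cos θ * u2 s θ))) := by
      rw [he1, he11, ← intervalIntegral.integral_const_mul, ← intervalIntegral.integral_const_mul,
        ← intervalIntegral.integral_add, ← intervalIntegral.integral_const_mul]
      · refine intervalIntegral.integral_congr_Ioo_of_le pi_pos.le fun θ hθ => ?_
        have := hw s hs θ hθ
        simp only [Pi.zero_apply, neg_zero] at this ⊢
        linear_combination 2 * u s θ * this
      · exact (intervalIntegrable_of_Icc ((continuousOn_sin.const_mul 2).mul
          ((cc s hsI).mul (cc1 s hsI)))).const_mul _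
      · exact (intervalIntegrable_of_Icc ((continuousOn_sin.const_mul 2).mul
          (((cc1 s hsI).pow 2).add ((cc s hsI).mul (cc11 s hsI))))).const_mul _
    rw [intervalIntegral.integral_sub, intervalIntegral.integral_const_mul, b0, mul_zero,
      sub_zero] at b1
    · have b2 : 0 ≤ ∫ θ in (0 : ℝ)..π,
          2 * sin θ * (s ^ 2 * radialCoeff M χ s * u1 s θ ^ 2 + u2 s θ ^ 2) := by
        refine intervalIntegral.integral_nonneg pi_pos.le fun θ hθ => ?_
        have := sin_nonneg_of_mem_Icc hθ
        positivity
      rw [← b1] at b2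
      exact nonneg_of_mul_nonneg_right b2 (by have := hs.1; positivity)
    · exact intervalIntegrable_of_Icc ((continuousOn_sin.const_mul 2).mul
        ((((cc1 s hsI).pow 2).const_mul _).add ((cc2 s hsI).pow 2)))
    · exact (intervalIntegrable_of_Icc ((continuousOn_sin.mul ((cc2 s hsI).pow 2)).add
          ((cc s hsI).mul ((continuousOn_sin.mul (cc22 s hsI)).add
            (continuousOn_cos.mul (cc2 s hsI)))))).const_mul _
  have hG : ∀ s ∈ I, HasDerivAt (fun s => radialCoeff M χ s * e1 s)
      (radialCoeffDeriv M χ s * e1 s + radialCoeff M χ s * e11 s) s := fun s hs =>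
    (hasDerivAt_radialCoeff M χ s).fun_mul (de1 s hs)
  have hmono : MonotoneOn (fun s => radialCoeff M χ s * e1 s) (Icc 0 s0) := by
    refine monotoneOn_of_deriv_nonneg (convex_Icc 0 s0)
      (fun s hs => (hG s (hI hs)).continuousAt.continuousWithinAt) ?_ ?_
    · rw [interior_Icc]
      exact fun s hs => (hG s (hI (Ioo_subset_Icc_self hs))).differentiableAt.differentiableWithinAt
    · rw [interior_Icc]
      intro s hs
      rw [(hG s (hI (Ioo_subset_Icc_self hs))).deriv]
      exact hflux s hs
  have he1neg : ∀ s ∈ Ioo 0 s0, e1 s ≤ 0 := by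
    intro s hs
    have h1 := hmono (Ioo_subset_Icc_self hs) (right_mem_Icc.2 hs0.le) hs.2.le
    simp only [hs0def, radialCoeff_horizon hM hχ, zero_mul] at h1
    exact nonpos_of_mul_nonpos_right h1 (radialCoeff_pos hM hχ hs)
  have hanti : AntitoneOn e (Icc 0 s0) := by
    refine antitoneOn_of_deriv_nonpos (convex_Icc 0 s0)
      (fun s hs => (de s (hI hs)).continuousAt.continuousWithinAt) ?_ ?_
    · rw [interior_Icc]
      exact fun s hs => (de s (hI (Ioo_subset_Icc_self hs))).differentiableAt.differentiableWithinAt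
    · rw [interior_Icc]
      intro s hs
      rw [(de s (hI (Ioo_subset_Icc_self hs))).deriv]
      exact he1neg s hs
  have he0 : e 0 = 0 := by
    rw [he]
    simp only
    rw [intervalIntegral.integral_congr (g := fun _ => (0 : ℝ)) fun θ hθ => ?_]
    · simp
    · rw [uIcc_of_le pi_pos.le] at hθ
      simp [h0 θ hθ]
  have hes : e s ≤ 0 := he0 ▸ hanti (left_mem_Icc.2 hs0.le) (Ioo_subset_Icc_self hs) hs.1.le
  have hsI : s ∈ I := hI (Ioo_subset_Icc_self hs)
  have hnn : ∀ θ ∈ Icc 0 π, 0 ≤ sin θ * u s θ ^ 2 := fun θ hθ =>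
    mul_nonneg (sin_nonneg_of_mem_Icc hθ) (sq_nonneg _)
  by_contra hne
  refine hes.not_gt (intervalIntegral.integral_pos pi_pos
    (continuousOn_sin.mul ((cc s hsI).pow 2)) (fun θ hθ => hnn θ (Ioc_subset_Icc_self hθ))
    ⟨θ, hθ, lt_of_le_of_ne (hnn θ hθ) (Ne.symm hne)⟩)

end DCS

namespace DCS

/-! ### Projection on `cos θ` and Green's identity with `r - M` -/

variable {M χ : ℝ} {I : Set ℝ} {u u1 u11 u2 u22 : ℝ → ℝ → ℝ}

/-- The projection of the wave equation on `cos θ`. -/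
theorem StripDerivs.dipole_ode (h : StripDerivs I u u1 u11 u2 u22)
    (hI : Icc 0 (rPlus M χ)⁻¹ ⊆ I)
    (hw : WaveEq M χ u1 u11 u2 u22 fun s θ => pontryaginDensity M χ s⁻¹ θ) {s : ℝ}
    (hs : s ∈ Ioo 0 (rPlus M χ)⁻¹) :
    s ^ 2 * (radialCoeff M χ s * (∫ θ in (0 : ℝ)..π, sin θ * cos θ * u11 s θ)
      + radialCoeffDeriv M χ s * ∫ θ in (0 : ℝ)..π, sin θ * cos θ * u1 s θ)
      - 2 * (∫ θ in (0 : ℝ)..π, sin θ * cos θ * u s θ) = -angularDensity M χ s⁻¹ := by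
  have hsI : s ∈ I := hI (Ioo_subset_Icc_self hs)
  have hw' : ContinuousOn (fun θ => sin θ * cos θ) (Icc 0 π) := by fun_prop
  have cc := continuousOn_slice h.c hsI
  have cc1 := continuousOn_slice h.c1 hsI
  have cc11 := continuousOn_slice h.c11 hsI
  have cc2 := continuousOn_slice h.c2 hsI
  have cc22 := continuousOn_slice h.c22 hsI
  have i0 : IntervalIntegrable (fun θ => sin θ * cos θ * u s θ) volume 0 π :=
    intervalIntegrable_of_Icc (hw'.mul cc)
  have i1 : IntervalIntegrable (fun θ => sin θ * cos θ * u1 s θ) volume 0 π :=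
    intervalIntegrable_of_Icc (hw'.mul cc1)
  have i11 : IntervalIntegrable (fun θ => sin θ * cos θ * u11 s θ) volume 0 π :=
    intervalIntegrable_of_Icc (hw'.mul cc11)
  have ib : IntervalIntegrable (fun θ => (sin θ * cos θ * u22 s θ + cos θ ^ 2 * u2 s θ)
      + 2 * (sin θ * cos θ * u s θ)) volume 0 π :=
    intervalIntegrable_of_Icc (((hw'.mul cc22).add ((continuousOn_cos.pow 2).mul cc2)).add
      ((hw'.mul cc).const_mul 2))
  -- Two integrations by parts in one: the primitive `sin θ cos θ ∂_θ u + sin² θ u` vanishes at the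
  -- poles, and the term `2 sin θ cos θ u` is the eigenvalue of `P₁`.
  have b0 : ∫ θ in (0 : ℝ)..π, ((sin θ * cos θ * u22 s θ + cos θ ^ 2 * u2 s θ)
      + 2 * (sin θ * cos θ * u s θ)) = 0 := by
    rw [intervalIntegral.integral_eq_sub_of_hasDerivAt
      (f := fun θ => sin θ * cos θ * u2 s θ + sin θ ^ 2 * u s θ) _ ib]
    · simp
    · intro θ hθ
      rw [uIcc_of_le pi_pos.le] at hθ
      exact ((((hasDerivAt_sin θ).fun_mul (hasDerivAt_cos θ)).fun_mul (h.d22 s hsI θ hθ)).fun_add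
        (((hasDerivAt_sin θ).fun_pow 2).fun_mul (h.d2 s hsI θ hθ))).congr_deriv (by simp; ring)
  refine Eq.trans ?_ (sub_zero _)
  refine Eq.trans ?_ (congrArg _ b0)
  rw [← integral_pontryaginDensity_mul_cos (inv_pos.2 hs.1), ← intervalIntegral.integral_neg,
    ← intervalIntegral.integral_sub _ ib, ← intervalIntegral.integral_const_mul,
    ← intervalIntegral.integral_const_mul, ← intervalIntegral.integral_add (i11.const_mul _)
    (i1.const_mul _), ← intervalIntegral.integral_const_mul, ← intervalIntegral.integral_const_mul,
    ← intervalIntegral.integral_sub _ (i0.const_mul _)]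
  · refine intervalIntegral.integral_congr_Ioo_of_le pi_pos.le fun θ hθ => ?_
    have := hw s hs θ hθ
    simp only at this ⊢
    linear_combination cos θ * this
  · exact ((i11.const_mul _).add (i1.const_mul _)).const_mul _
  · exact (((continuous_pontryaginDensity (inv_pos.2 hs.1)).mul
      continuous_cos).neg).intervalIntegrable _ _

/-- The coefficient of `1/r²` in the projection on `cos θ` of a solution of the wave equation. -/
theorem StripDerivs.dipole (hM : 0 < M) (hχ : |χ| ≤ 1) (h : StripDerivs I u u1 u11 u2 u22)
    (hI : Icc 0 (rPlus M χ)⁻¹ ⊆ I)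
    (hw : WaveEq M χ u1 u11 u2 u22 fun s θ => pontryaginDensity M χ s⁻¹ θ)
    (h0 : ∀ θ ∈ Icc 0 π, u 0 θ = 0) :
    3 / 2 * ∫ θ in (0 : ℝ)..π, sin θ * cos θ * u11 0 θ = -tailPrimitive M χ (rPlus M χ)⁻¹ := by
  have hs0 : 0 < (rPlus M χ)⁻¹ := inv_pos.2 (rPlus_pos hM)
  have hode := fun s hs => h.dipole_ode hI hw (s := s) hs
  have hhor := radialCoeff_horizon (χ := χ) hM hχ
  have hDpos := fun s hs => radialCoeff_pos hM hχ (s := s) hs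
  generalize (rPlus M χ)⁻¹ = s0 at *
  set p : ℝ → ℝ := fun s => ∫ θ in (0 : ℝ)..π, sin θ * cos θ * u s θ with hp
  set p1 : ℝ → ℝ := fun s => ∫ θ in (0 : ℝ)..π, sin θ * cos θ * u1 s θ with hp1
  set p11 : ℝ → ℝ := fun s => ∫ θ in (0 : ℝ)..π, sin θ * cos θ * u11 s θ with hp11
  have hwt : Continuous fun p : ℝ × ℝ => sin p.2 * cos p.2 := by fun_prop
  have hw' : ContinuousOn (fun θ => sin θ * cos θ) (Icc 0 π) := by fun_prop
  have dp : ∀ s ∈ I, HasDerivAt p (p1 s) s := fun s hs =>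
    hasDerivAt_intervalIntegral (f := fun s θ => sin θ * cos θ * u s θ)
      (f' := fun s θ => sin θ * cos θ * u1 s θ) pi_pos.le (h.isOpen.mem_nhds hs)
      (fun s hs => hw'.mul (continuousOn_slice h.c hs)) (hwt.continuousOn.mul h.c1)
      fun s hs θ hθ => (h.d1 s hs θ hθ).const_mul _
  have dp1 : ∀ s ∈ I, HasDerivAt p1 (p11 s) s := fun s hs =>
    hasDerivAt_intervalIntegral (f := fun s θ => sin θ * cos θ * u1 s θ)
      (f' := fun s θ => sin θ * cos θ * u11 s θ) pi_pos.le (h.isOpen.mem_nhds hs)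
      (fun s hs => hw'.mul (continuousOn_slice h.c1 hs)) (hwt.continuousOn.mul h.c11)
      fun s hs θ hθ => (h.d11 s hs θ hθ).const_mul _
  have h0I : (0 : ℝ) ∈ I := hI (left_mem_Icc.2 hs0.le)
  have p0 : p 0 = 0 := by
    rw [hp]
    simp only
    rw [intervalIntegral.integral_congr (g := fun _ => (0 : ℝ)) fun θ hθ => ?_]
    · simp
    · rw [uIcc_of_le pi_pos.le] at hθ
      simp [h0 θ hθ]
  -- `radialCoeff · N / s²` is minus `Δ` times the Wronskian `φ ∂_r p - p ∂_r φ` with `φ = r - M`,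
  -- written in `s = 1/r`. Green's identity says that it differs from `tailPrimitive` by a constant,
  -- namely `Z`.
  set N : ℝ → ℝ := fun s => (s - M * s ^ 2) * p1 s + p s with hN
  set Z : ℝ → ℝ := fun s => radialCoeff M χ s * N s / s ^ 2 - tailPrimitive M χ s with hZ
  have dN : ∀ s ∈ I, HasDerivAt N ((1 - 2 * M * s) * p1 s + (s - M * s ^ 2) * p11 s + p1 s) s :=
    fun s hs => by
      have hid := hasDerivAt_id' s
      refine (((hid.fun_sub ((hid.fun_pow 2).const_mul M)).fun_mul (dp1 s hs)).fun_add
        (dp s hs)).congr_deriv ?_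
      simp only [Nat.cast_ofNat, Nat.add_one_sub_one, pow_one, mul_one]
      ring
  have dZ' : ∀ s ∈ I, s ≠ 0 → HasDerivAt Z (((radialCoeffDeriv M χ s * N s + radialCoeff M χ s *
      ((1 - 2 * M * s) * p1 s + (s - M * s ^ 2) * p11 s + p1 s)) * s ^ 2
      - radialCoeff M χ s * N s * (2 * s)) / (s ^ 2) ^ 2
      - -(192 * M ^ 2 * (M * χ) * s ^ 2 * (1 - M * s)
      * (1 - (M * χ) ^ 2 * s ^ 2) / (1 + (M * χ) ^ 2 * s ^ 2) ^ 4)) s := by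
    intro s hsI hsne
    have hsq : HasDerivAt (fun s : ℝ => s ^ 2) (2 * s) s := by simpa using hasDerivAt_pow 2 s
    exact (((hasDerivAt_radialCoeff M χ s).fun_mul (dN s hsI)).fun_div hsq
      (pow_ne_zero 2 hsne)).fun_sub (hasDerivAt_tailPrimitive M χ s)
  have dZ : ∀ s ∈ Ioo 0 s0, HasDerivAt Z 0 s := by
    intro s hs
    have hsne := hs.1.ne'
    refine (dZ' s (hI (Ioo_subset_Icc_self hs)) hsne).congr_deriv ?_
    have ho := hode s hs
    have hang : angularDensity M χ s⁻¹ = 192 * M ^ 2 * (M * χ) * s ^ 5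
        * (1 - (M * χ) ^ 2 * s ^ 2) / (1 + (M * χ) ^ 2 * s ^ 2) ^ 4 := by
      have h1 : s⁻¹ ^ 2 + (M * χ) ^ 2 = (1 + (M * χ) ^ 2 * s ^ 2) / s ^ 2 := by field_simp
      have h2 : s⁻¹ ^ 2 - (M * χ) ^ 2 = (1 - (M * χ) ^ 2 * s ^ 2) / s ^ 2 := by field_simp
      rw [angularDensity, h1, h2]
      have h3 : 1 + (M * χ) ^ 2 * s ^ 2 ≠ 0 := by positivity
      field_simp
    have e1 : 192 * M ^ 2 * (M * χ) * s ^ 2 * (1 - M * s)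
      * (1 - (M * χ) ^ 2 * s ^ 2) / (1 + (M * χ) ^ 2 * s ^ 2) ^ 4 =
        (1 - M * s) / s ^ 3 * angularDensity M χ s⁻¹ := by
      rw [hang]
      have h3 : 1 + (M * χ) ^ 2 * s ^ 2 ≠ 0 := by positivity
      field_simp
    rw [e1]
    have e2 : angularDensity M χ s⁻¹ = -(s ^ 2 * (radialCoeff M χ s * p11 s
      + radialCoeffDeriv M χ s * p1 s) - 2 * p s) := by rw [hp, hp1, hp11]; linarith
    rw [e2, hN]
    unfold radialCoeff radialCoeffDeriv
    field_simp
    ring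
  -- The constant is evaluated at the horizon, where `radialCoeff` kills the Wronskian; `Z` is
  -- continuous there because the strip `I` extends beyond `s0`.
  have hconst : ∀ s ∈ Ioo 0 s0, radialCoeff M χ s * N s / s ^ 2 =
      tailPrimitive M χ s - tailPrimitive M χ s0 := by
    intro s hs
    have hc := constant_of_has_deriv_right_zero (f := Z) (a := s) (b := s0)
      (fun t ht => (dZ' t (hI ⟨hs.1.le.trans ht.1, ht.2⟩)
        (hs.1.trans_le ht.1).ne').continuousAt.continuousWithinAt)
      (fun t ht => (dZ t ⟨hs.1.trans_le ht.1, ht.2⟩).hasDerivWithinAt) s0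
      (right_mem_Icc.2 hs.2.le)
    simp only [hZ, hhor, zero_mul, zero_div, zero_sub] at hc
    linarith
  have hev : ∀ᶠ s in 𝓝[>] (0 : ℝ), s ∈ Ioo 0 s0 := Ioo_mem_nhdsGT hs0
  have hgt : 𝓝[>] (0 : ℝ) ≤ 𝓝[≠] 0 := nhdsWithin_mono 0 fun s hs => ne_of_gt hs
  have hid : Tendsto (fun s : ℝ => s) (𝓝[>] 0) (𝓝 0) := nhdsWithin_le_nhds
  have hD0 : Tendsto (radialCoeff M χ) (𝓝[>] 0) (𝓝 1) := by
    have := (hasDerivAt_radialCoeff M χ 0).continuousAt.tendsto.mono_left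
      (nhdsWithin_le_nhds (s := Ioi 0))
    simpa [radialCoeff] using this
  have hNlim : Tendsto (fun s => N s / s ^ 2) (𝓝[>] 0) (𝓝 (-tailPrimitive M χ s0)) := by
    have hT := ((hasDerivAt_tailPrimitive M χ 0).continuousAt.tendsto.mono_left
      (nhdsWithin_le_nhds (s := Ioi 0))).sub_const (tailPrimitive M χ s0)
    have hT0 : tailPrimitive M χ 0 = 0 := by simp [tailPrimitive]
    rw [hT0, zero_sub] at hT
    have := hT.div hD0 one_ne_zero
    rw [div_one] at this
    refine this.congr' ?_
    filter_upwards [hev] with s hs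
    have hD := (hDpos s hs).ne'
    have hsne := hs.1.ne'
    simp only [Pi.div_apply]
    rw [← hconst s hs]
    field_simp
  have hp1c : Tendsto p1 (𝓝[>] 0) (𝓝 (p1 0)) :=
    (dp1 0 h0I).continuousAt.tendsto.mono_left nhdsWithin_le_nhds
  have hps : Tendsto (fun s => p s / s) (𝓝[>] 0) (𝓝 (p1 0)) := by
    have := (hasDerivAt_iff_tendsto_slope.1 (dp 0 h0I)).mono_left hgt
    simpa [slope_fun_def_field, p0] using this
  -- Since `N / s²` has a finite limit, `N / s` tends to `0`; but its limit is also `2 p1(0)`. Thus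
  -- the `1/r` coefficient has no `ℓ = 1` part.
  have hp10 : p1 0 = 0 := by
    have h1 := hNlim.mul hid
    have h2 := ((hid.const_mul M).const_sub 1).mul hp1c |>.add hps
    have h3 := tendsto_nhds_unique (h2.congr' ?_) h1
    · simp only [mul_zero, sub_zero] at h3
      linarith
    · filter_upwards [hev] with s hs
      have hsne := hs.1.ne'
      simp only [hN]
      field_simp
  have hp1s : Tendsto (fun s => p1 s / s) (𝓝[>] 0) (𝓝 (p11 0)) := by
    have := (hasDerivAt_iff_tendsto_slope.1 (dp1 0 h0I)).mono_left hgt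
    simpa [slope_fun_def_field, hp10] using this
  have hps2 : Tendsto (fun s => p s / s ^ 2) (𝓝[>] 0) (𝓝 (p11 0 / 2)) := by
    have := (tendsto_taylor_two ((h.isOpen.eventually_mem h0I).mono dp) (dp1 0 h0I)).mono_left hgt
    simpa [p0, hp10] using this
  -- In `N / s²` the term with `p1` contributes `p11(0)` and the term `p` contributes `p11(0) / 2`,
  -- whence the factor `3/2` of the statement.
  have h2 := ((hid.const_mul M).const_sub 1).mul hp1s |>.add hps2
  have h3 := tendsto_nhds_unique (h2.congr' ?_) hNlim
  · simp only [mul_zero, sub_zero] at h3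
    linarith
  · filter_upwards [hev] with s hs
    have hsne := hs.1.ne'
    simp only [hN]
    field_simp

end DCS

namespace DCS

/-! ### Directional derivatives on an open set -/

/-- The derivative of `W` in the direction `v`. -/
def dirDeriv (v : ℝ × ℝ × ℝ) (W : ℝ × ℝ × ℝ → ℝ) (p : ℝ × ℝ × ℝ) : ℝ := fderiv ℝ W p v

section DirDeriv

variable {Q : Set (ℝ × ℝ × ℝ)} {W : ℝ × ℝ × ℝ → ℝ} {p : ℝ × ℝ × ℝ} {n : ℕ}

theorem contDiffOn_dirDeriv (hQ : IsOpen Q) (h : ContDiffOn ℝ (n + 1 : ℕ) W Q) (v : ℝ × ℝ × ℝ) :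
    ContDiffOn ℝ n (dirDeriv v W) Q :=
  (h.fderiv_of_isOpen hQ (m := n) (by norm_cast)).clm_apply contDiffOn_const

theorem hasDerivAt_dirDeriv (hQ : IsOpen Q) (h : ContDiffOn ℝ (n + 1 : ℕ) W Q)
    {c : ℝ → ℝ × ℝ × ℝ} {v : ℝ × ℝ × ℝ} {t : ℝ} (hc : HasDerivAt c v t) (ht : c t ∈ Q) :
    HasDerivAt (fun t => W (c t)) (dirDeriv v W (c t)) t :=
  (((h.contDiffAt (hQ.mem_nhds ht)).differentiableAt (by simp)).hasFDerivAt).comp_hasDerivAt t hc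

theorem dirDeriv_comm (hQ : IsOpen Q) (h : ContDiffOn ℝ 2 W Q) (hp : p ∈ Q) (v w : ℝ × ℝ × ℝ) :
    dirDeriv v (dirDeriv w W) p = dirDeriv w (dirDeriv v W) p := by
  have h1 := h.contDiffAt (hQ.mem_nhds hp)
  have h2 : DifferentiableAt ℝ (fderiv ℝ W) p :=
    (h1.fderiv_right (m := 1) (by norm_num)).differentiableAt (by simp)
  have h3 : ∀ v w, dirDeriv v (dirDeriv w W) p = fderiv ℝ (fderiv ℝ W) p v w := fun v w => by
    change fderiv ℝ (fun q => fderiv ℝ W q w) p v = _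
    rw [fderiv_clm_apply h2 (differentiableAt_const _)]
    simp
  have hs : IsSymmSndFDerivAt ℝ W p := h1.isSymmSndFDerivAt (by simp)
  rw [h3, h3, hs.eq]

theorem dirDeriv_congr {W' : ℝ × ℝ × ℝ → ℝ} (hQ : IsOpen Q) (h : ∀ q ∈ Q, W q = W' q) (hp : p ∈ Q)
    (v : ℝ × ℝ × ℝ) : dirDeriv v W p = dirDeriv v W' p := by
  have : W =ᶠ[𝓝 p] W' := (hQ.eventually_mem hp).mono h
  rw [dirDeriv, dirDeriv, this.fderiv_eq]

theorem hasDerivAt_line_fst (s θ ε : ℝ) :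
    HasDerivAt (fun ε : ℝ => ((ε, s, θ) : ℝ × ℝ × ℝ)) (1, 0, 0) ε :=
  (hasDerivAt_id' ε).prodMk ((hasDerivAt_const ε s).prodMk (hasDerivAt_const ε θ))

theorem hasDerivAt_line_snd (ε θ s : ℝ) :
    HasDerivAt (fun s : ℝ => ((ε, s, θ) : ℝ × ℝ × ℝ)) (0, 1, 0) s :=
  (hasDerivAt_const s ε).prodMk ((hasDerivAt_id' s).prodMk (hasDerivAt_const s θ))

theorem hasDerivAt_line_trd (ε s θ : ℝ) :
    HasDerivAt (fun θ : ℝ => ((ε, s, θ) : ℝ × ℝ × ℝ)) (0, 0, 1) θ :=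
  (hasDerivAt_const θ ε).prodMk ((hasDerivAt_const θ s).prodMk (hasDerivAt_id' θ))

theorem stripDerivs_of_contDiffOn {I : Set ℝ} (hQ : IsOpen Q) (h : ContDiffOn ℝ 2 W Q)
    (hI : IsOpen I) (hIQ : ∀ s ∈ I, ∀ θ ∈ Icc 0 π, ((0 : ℝ), s, θ) ∈ Q) :
    StripDerivs I (fun s θ => W (0, s, θ)) (fun s θ => dirDeriv (0, 1, 0) W (0, s, θ))
      (fun s θ => dirDeriv (0, 1, 0) (dirDeriv (0, 1, 0) W) (0, s, θ))
      (fun s θ => dirDeriv (0, 0, 1) W (0, s, θ))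
      (fun s θ => dirDeriv (0, 0, 1) (dirDeriv (0, 0, 1) W) (0, s, θ)) := by
  have h1 : ∀ v, ContDiffOn ℝ (1 : ℕ) (dirDeriv v W) Q := fun v =>
    contDiffOn_dirDeriv hQ (by exact_mod_cast h) v
  have h2 : ∀ v, ContDiffOn ℝ (0 : ℕ) (dirDeriv v (dirDeriv v W)) Q := fun v =>
    contDiffOn_dirDeriv hQ (h1 v) v
  have hc : ∀ V : ℝ × ℝ × ℝ → ℝ, ContinuousOn V Q →
      ContinuousOn (fun p : ℝ × ℝ => V (0, p.1, p.2)) (I ×ˢ Icc 0 π) := fun V hV =>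
    hV.comp (by fun_prop : Continuous fun p : ℝ × ℝ => ((0 : ℝ), p.1, p.2)).continuousOn
      fun p hp => hIQ p.1 hp.1 p.2 hp.2
  exact
    { isOpen := hI
      d1 := fun s hs θ hθ => hasDerivAt_dirDeriv (n := 1) hQ (by exact_mod_cast h)
        (hasDerivAt_line_snd 0 θ s) (hIQ s hs θ hθ)
      d11 := fun s hs θ hθ => hasDerivAt_dirDeriv (n := 0) hQ (h1 _)
        (hasDerivAt_line_snd 0 θ s) (hIQ s hs θ hθ)
      d2 := fun s hs θ hθ => hasDerivAt_dirDeriv (n := 1) hQ (by exact_mod_cast h)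
        (hasDerivAt_line_trd 0 s θ) (hIQ s hs θ hθ)
      d22 := fun s hs θ hθ => hasDerivAt_dirDeriv (n := 0) hQ (h1 _)
        (hasDerivAt_line_trd 0 s θ) (hIQ s hs θ hθ)
      c := hc _ h.continuousOn
      c1 := hc _ (h1 _).continuousOn
      c11 := hc _ (h2 _).continuousOn
      c2 := hc _ (h1 _).continuousOn
      c22 := hc _ (h2 _).continuousOn }

end DirDeriv

/-- Smoothness of the scalar is assumed near each point of the compact rectangle at `ε = 0`.
Compactness makes the range of couplings uniform in `(s, θ)`, and the open set `I` reaches beyond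
both the horizon and infinity. -/
theorem exists_tube {Q : Set (ℝ × ℝ × ℝ)} (hQ : IsOpen Q) {s₀ : ℝ}
    (h : ∀ s ∈ Icc 0 s₀, ∀ θ ∈ Icc 0 π, ((0 : ℝ), s, θ) ∈ Q) :
    ∃ E I : Set ℝ, IsOpen E ∧ (0 : ℝ) ∈ E ∧ IsOpen I ∧ Icc 0 s₀ ⊆ I ∧
      ∀ ε ∈ E, ∀ s ∈ I, ∀ θ ∈ Icc 0 π, (ε, s, θ) ∈ Q := by
  obtain ⟨E, J, hE, hJ, h0E, hJs, hEJ⟩ := generalized_tube_lemma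
    (isCompact_singleton (x := (0 : ℝ)))
    ((isCompact_Icc (a := (0 : ℝ)) (b := s₀)).prod (isCompact_Icc (a := 0) (b := π))) hQ (by
      rintro ⟨ε, s, θ⟩ ⟨hε, hs, hθ⟩
      rw [mem_singleton_iff] at hε
      subst hε
      exact h s hs θ hθ)
  obtain ⟨I, K, hI, -, hIs, hKs, hIK⟩ := generalized_tube_lemma
    (isCompact_Icc (a := (0 : ℝ)) (b := s₀)) (isCompact_Icc (a := 0) (b := π)) hJ hJs
  exact ⟨E, I, hE, h0E rfl, hI, hIs, fun ε hε s hs θ hθ => hEJ ⟨hε, hIK ⟨hs, hKs hθ⟩⟩⟩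

/-! ### The wave equation in the coordinate `1/r` -/

variable {M χ : ℝ} {I : Set ℝ} {u u1 u11 u2 u22 ρ : ℝ → ℝ → ℝ}

theorem inv_mem_Ioo {r : ℝ} (hM : 0 < M) (hr : rPlus M χ < r) : r⁻¹ ∈ Ioo 0 (rPlus M χ)⁻¹ :=
  ⟨inv_pos.2 ((rPlus_pos hM).trans hr), inv_strictAnti₀ (rPlus_pos hM) hr⟩

theorem StripDerivs.box_kerr (hM : 0 < M) (hχ : |χ| ≤ 1) (h : StripDerivs I u u1 u11 u2 u22)
    (hI : Icc 0 (rPlus M χ)⁻¹ ⊆ I) {f : ℝ → ℝ → ℝ}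
    (hf : ∀ r, rPlus M χ < r → ∀ θ ∈ Ioo 0 π, f r θ = u r⁻¹ θ) {x : Coord}
    (hx : x ∈ exterior M χ) :
    box (kerr M χ) (stationaryScalar f) x * sqrtNegDet (kerr M χ) x =
      sin (x 2) * ((x 1)⁻¹ ^ 2 * (radialCoeff M χ (x 1)⁻¹ * u11 (x 1)⁻¹ (x 2)
        + radialCoeffDeriv M χ (x 1)⁻¹ * u1 (x 1)⁻¹ (x 2)) + u22 (x 1)⁻¹ (x 2))
      + cos (x 2) * u2 (x 1)⁻¹ (x 2) := by
  obtain ⟨hr, hθ⟩ := hx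
  have hpos := (rPlus_pos hM).trans hr
  have hD := kerrDelta_pos hM hχ hr
  have hs := sin_pos_of_mem_Ioo hθ
  have hB := DCS.box_kerr hM hχ ⟨hr, hθ⟩ f
  have hmem : ∀ r, rPlus M χ < r → r⁻¹ ∈ I := fun r hr =>
    hI (Ioo_subset_Icc_self (inv_mem_Ioo hM hr))
  have hθ' := Ioo_subset_Icc_self hθ
  have dinv : ∀ r, rPlus M χ < r → HasDerivAt (fun r : ℝ => r⁻¹) (-(r ^ 2)⁻¹) r := fun r hr =>
    hasDerivAt_inv ((rPlus_pos hM).trans hr).ne'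
  have d1 : ∀ r, rPlus M χ < r →
      HasDerivAt (fun r => f r (x 2)) (u1 r⁻¹ (x 2) * -(r ^ 2)⁻¹) r := fun r hr =>
    ((h.d1 _ (hmem r hr) _ hθ').comp r (dinv r hr)).congr_of_eventuallyEq
      ((eventually_gt_nhds hr).mono fun r' hr' => hf r' hr' _ hθ)
  have d11 : HasDerivAt (deriv fun r => f r (x 2)) (u11 (x 1)⁻¹ (x 2) * -(x 1 ^ 2)⁻¹ *
      -(x 1 ^ 2)⁻¹ + u1 (x 1)⁻¹ (x 2) * (2 * x 1 / (x 1 ^ 2) ^ 2)) (x 1) := by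
    have e1 : HasDerivAt (fun r : ℝ => -(r ^ 2)⁻¹) (2 * x 1 / (x 1 ^ 2) ^ 2) (x 1) := by
      have := ((hasDerivAt_pow 2 (x 1)).fun_inv (pow_ne_zero 2 hpos.ne')).fun_neg
      exact this.congr_deriv (by simp; ring)
    exact (((h.d11 _ (hmem _ hr) _ hθ').comp (x 1) (dinv _ hr)).fun_mul
      e1).congr_of_eventuallyEq ((eventually_gt_nhds hr).mono fun r' hr' => (d1 r' hr').deriv)
  have d2 : ∀ θ ∈ Ioo 0 π, HasDerivAt (fun θ => f (x 1) θ) (u2 (x 1)⁻¹ θ) θ := fun θ hθ =>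
    (h.d2 _ (hmem _ hr) _ (Ioo_subset_Icc_self hθ)).congr_of_eventuallyEq
      ((isOpen_Ioo.eventually_mem hθ).mono fun θ' hθ' => hf _ hr θ' hθ')
  have d22 : HasDerivAt (deriv fun θ => f (x 1) θ) (u22 (x 1)⁻¹ (x 2)) (x 2) :=
    (h.d22 _ (hmem _ hr) _ hθ').congr_of_eventuallyEq
      ((isOpen_Ioo.eventually_mem hθ).mono fun θ' hθ' => (d2 θ' hθ').deriv)
  rw [d11.deriv, (d1 _ hr).deriv, d22.deriv, (d2 _ hθ).deriv] at hB
  rw [sqrtNegDet_kerr hpos hD.ne' hθ, mul_comm, mul_right_comm, hB]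
  unfold radialCoeff radialCoeffDeriv kerrDelta
  field_simp
  ring

/-- The scalar field equation on Kerr, as a wave equation in the coordinates `s = 1/r`, `θ`. -/
theorem StripDerivs.waveEq (hM : 0 < M) (hχ : |χ| ≤ 1) (h : StripDerivs I u u1 u11 u2 u22)
    (hI : Icc 0 (rPlus M χ)⁻¹ ⊆ I) {f : ℝ → ℝ → ℝ}
    (hf : ∀ r, rPlus M χ < r → ∀ θ ∈ Ioo 0 π, f r θ = u r⁻¹ θ)
    (hbox : ∀ x ∈ exterior M χ, box (kerr M χ) (stationaryScalar f) x * sqrtNegDet (kerr M χ) x =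
      -ρ (x 1)⁻¹ (x 2)) : WaveEq M χ u1 u11 u2 u22 ρ := by
  -- The field is stationary and axisymmetric, so testing at `t = φ = 0` loses nothing.
  intro s hs θ hθ
  have hx : (![0, s⁻¹, θ, 0] : Coord) ∈ exterior M χ :=
    ⟨(lt_inv_comm₀ hs.1 (rPlus_pos hM)).1 hs.2, hθ⟩
  have h1 := h.box_kerr hM hχ hI hf hx
  rw [hbox _ hx] at h1
  simpa using h1.symm

/-- If `u` vanishes on the exterior, its second derivative vanishes at infinity. -/
theorem StripDerivs.snd_deriv_eq_zero (h : StripDerivs I u u1 u11 u2 u22) {s₀ : ℝ} (hs₀ : 0 < s₀)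
    (hI : Icc 0 s₀ ⊆ I) {θ : ℝ} (hθ : θ ∈ Icc 0 π) (hz : ∀ s ∈ Ioo 0 s₀, u s θ = 0) :
    u11 0 θ = 0 := by
  have z : ∀ f f' : ℝ → ℝ, (∀ s ∈ Ioo 0 s₀, f s = 0) →
      (∀ s ∈ Ioo 0 s₀, HasDerivAt f (f' s) s) → ∀ s ∈ Ioo 0 s₀, f' s = 0 := by
    intro f f' hf hd s hs
    have he : f =ᶠ[𝓝 s] fun _ => 0 := (isOpen_Ioo.eventually_mem hs).mono hf
    exact ((hd s hs).congr_of_eventuallyEq he.symm).unique (hasDerivAt_const s 0)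
  have hsub : Ioo 0 s₀ ⊆ I := Ioo_subset_Icc_self.trans hI
  have z1 := z _ _ hz fun s hs => h.d1 s (hsub hs) θ hθ
  have z2 := z _ _ z1 fun s hs => h.d11 s (hsub hs) θ hθ
  have h0 : (0 : ℝ) ∈ I := hI (left_mem_Icc.2 hs₀.le)
  have hc : ContinuousOn (fun s => u11 s θ) I :=
    h.c11.comp (by fun_prop : Continuous fun s : ℝ => (s, θ)).continuousOn fun s hs => ⟨hs, hθ⟩
  have ht : Tendsto (fun s => u11 s θ) (𝓝[>] 0) (𝓝 (u11 0 θ)) :=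
    (hc.continuousAt (h.isOpen.mem_nhds h0)).tendsto.mono_left nhdsWithin_le_nhds
  refine tendsto_nhds_unique ht (tendsto_const_nhds.congr' ?_)
  filter_upwards [Ioo_mem_nhdsGT hs₀] with s hs using (z2 s hs).symm

end DCS

namespace DCS

variable {M χ : ℝ}

/-! ### The dipole hair of a family of solutions -/

namespace Family

variable (F : Family M χ)

theorem metric_zero_eventuallyEq {x : Coord} (hx : x ∈ exterior M χ) :
    stationaryMetric (F.metric 0) =ᶠ[𝓝 x] kerr M χ :=
  ((isOpen_exterior M χ).eventually_mem hx).mono fun _ hy => F.metric_zero _ _ hy.1 hy.2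

theorem field_eq_at {x : Coord} (hx : x ∈ exterior M χ) : ∀ᶠ ε in 𝓝 (0 : ℝ),
    box (stationaryMetric (F.metric ε)) (stationaryScalar (F.scalar ε)) x
      + ε * pontryagin (stationaryMetric (F.metric ε)) x = 0 := by
  have h : ![x 0, x 1, x 2, x 3] = x := by ext i; fin_cases i <;> rfl
  filter_upwards [F.field_eq (x 1) (x 2) hx.1 hx.2] with ε hε
  have := hε (x 0) (x 3)
  rwa [h] at this

theorem box_zero {x : Coord} (hx : x ∈ exterior M χ) :
    box (kerr M χ) (stationaryScalar (F.scalar 0)) x = 0 := by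
  have h := (F.field_eq_at hx).self_of_nhds
  rwa [zero_mul, add_zero, box_congr (F.metric_zero_eventuallyEq hx) EventuallyEq.rfl] at h

theorem smoothMetricAt (hM : 0 < M) (hχ : |χ| ≤ 1) {x : Coord} (hx : x ∈ exterior M χ) :
    SmoothMetricAt (fun ε => stationaryMetric (F.metric ε)) x where
  smooth i j := by
    have h : ContDiff ℝ ∞ fun p : ℝ × Coord => (p.1, p.2 1, p.2 2) := by fun_prop
    exact ContDiffAt.comp (g := fun p : ℝ × ℝ × ℝ => F.metric p.1 p.2.1 p.2.2 i j)
      (f := fun p : ℝ × Coord => (p.1, p.2 1, p.2 2)) (0, x)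
      (F.metric_smooth (x 1) (x 2) hx.1 hx.2 i j) h.contDiffAt
  det_neg := by
    have hpos := (rPlus_pos hM).trans hx.1
    have h := sqrtNegDet_kerr hpos (kerrDelta_pos hM hχ hx.1).ne' hx.2
    have h1 : 0 < sqrtNegDet (kerr M χ) x := by
      rw [h]; exact mul_pos (kerrSigma_pos hpos) (sin_pos_of_mem_Ioo hx.2)
    rw [(F.metric_zero_eventuallyEq hx).eq_of_nhds]
    exact neg_pos.1 (Real.sqrt_pos.1 h1)

theorem smoothFamilyAt {U : ℝ × ℝ × ℝ → ℝ} (hU : ∀ ε r θ, 0 < r → F.scalar ε r θ = U (ε, 1 / r, θ))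
    {x : Coord} (hr : 0 < x 1) (h : ContDiffAt ℝ ∞ U (0, 1 / x 1, x 2)) :
    SmoothFamilyAt (fun ε => stationaryScalar (F.scalar ε)) x := by
  have h1 : ContDiffAt ℝ ∞ (fun p : ℝ × Coord => p.2 1) (0, x) := by fun_prop
  have h2 : ContDiffAt ℝ ∞ (fun p : ℝ × Coord => p.2 2) (0, x) := by fun_prop
  have h3 : ContDiffAt ℝ ∞ (fun p : ℝ × Coord => (p.1, 1 / p.2 1, p.2 2)) (0, x) :=
    contDiffAt_fst.prodMk ((contDiffAt_const.div h1 hr.ne').prodMk h2)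
  refine (ContDiffAt.comp (0, x) h h3).congr_of_eventuallyEq ?_
  have hc : ContinuousAt (fun p : ℝ × Coord => p.2 1) (0, x) := h1.continuousAt
  filter_upwards [hc.eventually (eventually_gt_nhds hr)] with p hp using hU _ _ _ hp

/-- The scalar field vanishes at zero coupling: Kerr has no regular scalar hair. -/
theorem scalar_zero (hM : 0 < M) (hχ : |χ| ≤ 1) {I : Set ℝ} {u u1 u11 u2 u22 : ℝ → ℝ → ℝ}
    (h : StripDerivs I u u1 u11 u2 u22) (hI : Icc 0 (rPlus M χ)⁻¹ ⊆ I)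
    (hu : ∀ r, rPlus M χ < r → ∀ θ ∈ Ioo 0 π, F.scalar 0 r θ = u r⁻¹ θ)
    (h0 : ∀ θ ∈ Icc 0 π, u 0 θ = 0) {s θ : ℝ} (hs : s ∈ Ioo 0 (rPlus M χ)⁻¹) (hθ : θ ∈ Ioo 0 π) :
    u s θ = 0 := by
  have hw : WaveEq M χ u1 u11 u2 u22 0 := h.waveEq hM hχ hI hu fun x hx => by
    rw [F.box_zero hx]; simp
  have := h.eq_zero hM hχ hI hw h0 hs (Ioo_subset_Icc_self hθ)
  simpa [(sin_pos_of_mem_Ioo hθ).ne'] using this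

/-- The first-order perturbation of the scalar field is sourced by the Pontryagin density of
Kerr. -/
theorem box_couplingDeriv (hM : 0 < M) (hχ : |χ| ≤ 1) {U : ℝ × ℝ × ℝ → ℝ}
    (hU : ∀ ε r θ, 0 < r → F.scalar ε r θ = U (ε, 1 / r, θ))
    (hUs : ∀ s ∈ Icc 0 (1 / rPlus M χ), ∀ θ ∈ Icc 0 π, ContDiffAt ℝ ∞ U (0, s, θ))
    (h0 : ∀ s ∈ Ioo 0 (rPlus M χ)⁻¹, ∀ θ ∈ Ioo 0 π, U (0, s, θ) = 0) {x : Coord}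
    (hx : x ∈ exterior M χ) :
    box (kerr M χ) (stationaryScalar fun r θ => deriv (fun ε => F.scalar ε r θ) 0) x
      * sqrtNegDet (kerr M χ) x = -pontryaginDensity M χ (x 1) (x 2) := by
  have hpos := (rPlus_pos hM).trans hx.1
  have hsm : SmoothFamilyAt (fun ε => stationaryScalar (F.scalar ε)) x := by
    refine F.smoothFamilyAt hU hpos (hUs _ ?_ _ (Ioo_subset_Icc_self hx.2))
    rw [one_div, one_div]
    exact Ioo_subset_Icc_self (inv_mem_Ioo hM hx.1)
  have hz : stationaryScalar (F.scalar 0) =ᶠ[𝓝 x] 0 := by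
    filter_upwards [(isOpen_exterior M χ).eventually_mem hx] with y hy
    change F.scalar 0 (y 1) (y 2) = 0
    rw [hU _ _ _ ((rPlus_pos hM).trans hy.1), one_div]
    exact h0 _ (inv_mem_Ioo hM hy.1) _ hy.2
  have h := (F.smoothMetricAt hM hχ hx).box_couplingDeriv hsm hz (F.field_eq_at hx)
  rw [box_congr (F.metric_zero_eventuallyEq hx) EventuallyEq.rfl,
    pontryagin_congr (F.metric_zero_eventuallyEq hx)] at h
  change box (kerr M χ) (couplingDeriv fun ε => stationaryScalar (F.scalar ε)) x * _ = _
  rw [h, neg_mul, pontryagin_kerr_mul_sqrtNegDet hM hχ hx]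
  rfl

theorem legendreOne_isBigO (hM : 0 < M) (hχ : |χ| ≤ 1) {μ₁ μ₂ : ℝ → ℝ → ℝ}
    (hμ : IsHair F.scalar μ₁ μ₂) :
    (fun ε : ℝ => legendreOne (μ₂ ε) - -(tailPrimitive M χ (rPlus M χ)⁻¹) / 2 * ε)
      =O[𝓝 0] fun ε : ℝ => ε ^ 2 := by
  obtain ⟨U, hUs, hU⟩ := F.scalar_smooth
  have hs₀ : 0 < (rPlus M χ)⁻¹ := inv_pos.2 (rPlus_pos hM)
  -- Four derivatives are used: two in `s` to extract the `1/r²` coefficient, and two in `ε` for the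
  -- quadratic remainder.
  set Q : Set (ℝ × ℝ × ℝ) := {p | ContDiffAt ℝ 4 U p}
  have hQ : IsOpen Q := isOpen_iff_mem_nhds.2 fun p hp =>
    (show ContDiffAt ℝ 4 U p from hp).eventually (by simp)
  have c0 : ContDiffOn ℝ (4 : ℕ) U Q := fun p hp =>
    (show ContDiffAt ℝ 4 U p from hp).contDiffWithinAt
  obtain ⟨E, I, hE, h0E, hI, hsI, hEI⟩ := exists_tube (s₀ := (rPlus M χ)⁻¹) hQ
    fun s hs θ hθ => (hUs s (by rwa [one_div]) θ hθ).of_le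
      (WithTop.coe_le_coe.2 (le_top : (4 : ℕ∞) ≤ ⊤))
  have h0I : (0 : ℝ) ∈ I := hsI (left_mem_Icc.2 hs₀.le)
  set es : ℝ × ℝ × ℝ := (0, 1, 0)
  set eε : ℝ × ℝ × ℝ := (1, 0, 0)
  have cs : ContDiffOn ℝ (3 : ℕ) (dirDeriv es U) Q := contDiffOn_dirDeriv hQ c0 _
  have cε : ContDiffOn ℝ (3 : ℕ) (dirDeriv eε U) Q := contDiffOn_dirDeriv hQ c0 _
  have css : ContDiffOn ℝ (2 : ℕ) (dirDeriv es (dirDeriv es U)) Q := contDiffOn_dirDeriv hQ cs _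
  set A := dirDeriv es (dirDeriv es U) with hA
  have cA1 : ContDiffOn ℝ (1 : ℕ) (dirDeriv eε A) Q := contDiffOn_dirDeriv hQ css _
  -- the coefficients of the expansion in `1/r`
  have hcoef : ∀ᶠ ε in 𝓝 (0 : ℝ), ∀ θ ∈ Icc 0 π, U (ε, 0, θ) = 0 ∧ μ₂ ε θ = A (ε, 0, θ) / 2 := by
    filter_upwards [hμ, hE.mem_nhds h0E] with ε hε hεE θ hθ
    refine expansion_coeff (f := fun s => U (ε, s, θ)) (f1 := fun s => dirDeriv es U (ε, s, θ))
      (m₁ := μ₁ ε θ) ?_ (hasDerivAt_dirDeriv (n := 2) hQ cs (hasDerivAt_line_snd ε θ 0)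
        (hEI ε hεE 0 h0I θ hθ)) ((hε θ hθ).congr' ?_ EventuallyEq.rfl)
    · filter_upwards [hI.mem_nhds h0I] with s hs
      exact hasDerivAt_dirDeriv (n := 3) hQ c0 (hasDerivAt_line_snd ε θ s) (hEI ε hεE s hs θ hθ)
    · filter_upwards [eventually_gt_atTop 0] with r hr
      rw [hU ε r θ hr]
  have hcoef0 := hcoef.self_of_nhds
  -- no hair at zero coupling
  have hstrip := stripDerivs_of_contDiffOn hQ (c0.of_le (by norm_num)) hI (hEI 0 h0E)
  have hz : ∀ s ∈ Ioo 0 (rPlus M χ)⁻¹, ∀ θ ∈ Ioo 0 π, U (0, s, θ) = 0 := fun s hs θ hθ =>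
    F.scalar_zero hM hχ hstrip hsI
      (fun r hr θ _ => by rw [hU 0 r θ ((rPlus_pos hM).trans hr), one_div])
      (fun θ hθ => (hcoef0 θ hθ).1) hs hθ
  have hA0 : ∀ θ ∈ Ioo 0 π, A (0, 0, θ) = 0 := fun θ hθ =>
    hstrip.snd_deriv_eq_zero hs₀ hsI (Ioo_subset_Icc_self hθ) fun s hs => hz s hs θ hθ
  -- the first-order perturbation
  have hstrip1 := stripDerivs_of_contDiffOn hQ (cε.of_le (by norm_num)) hI (hEI 0 h0E)
  have hV : ∀ s ∈ I, ∀ θ ∈ Icc 0 π,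
      HasDerivAt (fun ε => U (ε, s, θ)) (dirDeriv eε U (0, s, θ)) 0 := fun s hs θ hθ =>
    hasDerivAt_dirDeriv (n := 3) hQ c0 (hasDerivAt_line_fst s θ 0) (hEI 0 h0E s hs θ hθ)
  have hw := hstrip1.waveEq hM hχ hsI (f := fun r θ => deriv (fun ε => F.scalar ε r θ) 0)
    (ρ := fun s θ => pontryaginDensity M χ s⁻¹ θ)
    (fun r hr θ hθ => by
      simp only [hU _ r θ ((rPlus_pos hM).trans hr), one_div]
      exact (hV _ (hsI (Ioo_subset_Icc_self (inv_mem_Ioo hM hr))) θ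
        (Ioo_subset_Icc_self hθ)).deriv)
    (fun x hx => by rw [F.box_couplingDeriv hM hχ hU hUs hz hx, inv_inv])
  -- The expansion gives `U (ε, 0, θ) = 0` for all small `ε`, so the first-order field also vanishes
  -- at infinity.
  have hdip := hstrip1.dipole hM hχ hsI hw fun θ hθ =>
    ((hV 0 h0I θ hθ).congr_of_eventuallyEq (hcoef.mono fun ε hε => ((hε θ hθ).1).symm)).unique
      (hasDerivAt_const 0 (0 : ℝ))
  -- The slope in `ε` of the `1/r²` coefficient is thereby the `1/r²` coefficient of the first-order
  -- field, to which `hdip` applies.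
  have hcomm : ∀ θ ∈ Icc 0 π, dirDeriv eε A (0, 0, θ) =
      dirDeriv es (dirDeriv es (dirDeriv eε U)) (0, 0, θ) := fun θ hθ => by
    have hp := hEI 0 h0E 0 h0I θ hθ
    rw [hA, dirDeriv_comm hQ (cs.of_le (by norm_num)) hp]
    exact dirDeriv_congr hQ (fun q hq => dirDeriv_comm hQ (c0.of_le (by norm_num)) hq _ _) hp _
  -- the dipole hair as a function of the coupling
  have hcont : ∀ W : ℝ × ℝ × ℝ → ℝ, ContinuousOn W Q → ContinuousOn
      (fun p : ℝ × ℝ => W (p.1, 0, p.2) / 2 * cos p.2 * sin p.2) (E ×ˢ Icc 0 π) := fun W hW =>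
    (((hW.comp (by fun_prop : Continuous fun p : ℝ × ℝ => (p.1, (0 : ℝ), p.2)).continuousOn
      fun p hp => hEI p.1 hp.1 0 h0I p.2 hp.2).div_const 2).mul (by fun_prop)).mul (by fun_prop)
  have hderiv : ∀ W : ℝ × ℝ × ℝ → ℝ, ContDiffOn ℝ (0 + 1 : ℕ) W Q → ∀ ε ∈ E, HasDerivAt
      (fun ε => 3 / 2 * ∫ θ in (0 : ℝ)..π, W (ε, 0, θ) / 2 * cos θ * sin θ)
      (3 / 2 * ∫ θ in (0 : ℝ)..π, dirDeriv eε W (ε, 0, θ) / 2 * cos θ * sin θ) ε :=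
    fun W hW ε hε => (hasDerivAt_intervalIntegral
      (f := fun ε θ => W (ε, 0, θ) / 2 * cos θ * sin θ)
      (f' := fun ε θ => dirDeriv eε W (ε, 0, θ) / 2 * cos θ * sin θ) pi_pos.le (hE.mem_nhds hε)
      (fun ε hε => continuousOn_slice (f := fun ε θ => W (ε, 0, θ) / 2 * cos θ * sin θ)
        (hcont W hW.continuousOn) hε)
      (hcont _ (contDiffOn_dirDeriv hQ hW eε).continuousOn) fun ε hε θ hθ =>
      (((hasDerivAt_dirDeriv (n := 0) hQ hW (hasDerivAt_line_fst 0 θ ε)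
        (hEI ε hε 0 h0I θ hθ)).div_const 2).mul_const _).mul_const _).const_mul _
  have hbig := isBigO_sub_linear
    ((hE.eventually_mem h0E).mono (hderiv A (css.of_le (by norm_num)))) (hderiv _ cA1 0 h0E) (by
      rw [intervalIntegral.integral_congr_Ioo_of_le (g := fun _ => (0 : ℝ)) pi_pos.le
        fun θ hθ => by simp [hA0 θ hθ]]
      simp)
  -- The factor `1/2` against `hdip` is the Taylor factor in `μ₂ = A / 2`.
  have hslope : 3 / 2 * ∫ θ in (0 : ℝ)..π, dirDeriv eε A (0, 0, θ) / 2 * cos θ * sin θ =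
      -(tailPrimitive M χ (rPlus M χ)⁻¹) / 2 := by
    rw [← hdip, mul_div_right_comm, ← intervalIntegral.integral_const_mul,
      ← intervalIntegral.integral_const_mul]
    refine intervalIntegral.integral_congr_Ioo_of_le pi_pos.le fun θ hθ => ?_
    rw [hcomm θ (Ioo_subset_Icc_self hθ)]
    ring
  rw [hslope] at hbig
  refine hbig.congr' (hcoef.mono fun ε hε => ?_) EventuallyEq.rfl
  have hl : legendreOne (μ₂ ε) = 3 / 2 * ∫ θ in (0 : ℝ)..π, A (ε, 0, θ) / 2 * cos θ * sin θ := by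
    rw [legendreOne, intervalIntegral.integral_congr_Ioo_of_le pi_pos.le
      fun θ hθ => by rw [(hε θ (Ioo_subset_Icc_self hθ)).2]]
  simp only [hl]

end Family

end DCS
end

theorem mainTheorem9 (M χ : ℝ) (hM : 0 < M) (hχ0 : χ ≠ 0) (hχ1 : |χ| ≤ 1) :
    -- `φ₀` solves the homogeneous equation on the Kerr exterior and behaves as `r cos θ` at infinity
    (∀ t r θ φ : ℝ, DCS.rPlus M χ < r → θ ∈ Ioo 0 π →
      DCS.box (DCS.kerr M χ) (DCS.phi0 M) ![t, r, θ, φ] = 0) ∧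
    (∀ t θ φ : ℝ, cos θ ≠ 0 →
      Tendsto (fun r => DCS.phi0 M ![t, r, θ, φ] / (r * cos θ)) atTop (𝓝 1)) ∧
    -- the integral of the Pontryagin density against `φ₀`
    IntegrableOn (DCS.hairIntegrand M χ) (DCS.slice M χ) ∧
    (∀ ε : ℝ, ε / (4 * π) * ∫ p in DCS.slice M χ, DCS.hairIntegrand M χ p =
      2 * ε * (2 * χ ^ 4 + (2 * √(1 - χ ^ 2) - 3) * χ ^ 2 - 2 * √(1 - χ ^ 2) + 2) / χ ^ 3) ∧
    -- the `ℓ = 1` dipole hair to first order in the coupling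
    (∀ (F : DCS.Family M χ) (μ₁ μ₂ : ℝ → ℝ → ℝ), DCS.IsHair F.scalar μ₁ μ₂ →
      (fun ε : ℝ => DCS.legendreOne (μ₂ ε) -
        2 * ε * (2 * χ ^ 4 + (2 * √(1 - χ ^ 2) - 3) * χ ^ 2 - 2 * √(1 - χ ^ 2) + 2) / χ ^ 3)
        =O[𝓝 0] fun ε : ℝ => ε ^ 2) := by
  have hT := DCS.tailPrimitive_rPlus hM hχ0 hχ1
  -- Integral and hair meet here: the integral is `-2π` times the horizon value of `tailPrimitive`,
  -- and the factor `ε / (4π)` turns it into the slope of the hair.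
  have hcoef : ∀ ε : ℝ, 2 * ε * (2 * χ ^ 4 + (2 * √(1 - χ ^ 2) - 3) * χ ^ 2 - 2 * √(1 - χ ^ 2) + 2)
      / χ ^ 3 = -(DCS.tailPrimitive M χ (DCS.rPlus M χ)⁻¹) / 2 * ε := fun ε => by rw [hT]; ring
  refine ⟨fun t r θ φ hr hθ => DCS.box_phi0 hM hχ1 t φ hr hθ,
    fun t θ φ hθ => DCS.tendsto_phi0_div t φ hθ, DCS.integrableOn_hairIntegrand hM hχ1,
    fun ε => ?_, fun F μ₁ μ₂ hμ => ?_⟩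
  · rw [hcoef, DCS.integral_hairIntegrand hM hχ1]
    have := pi_pos.ne'
    field_simp
    ring
  · simp only [hcoef]
    exact F.legendreOne_isBigO hM hχ1 hμ
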